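/- **Setting.** Let $\mathsf{Sig}$ be the category of signatures: an object $X$ is a family of sets $X(n,m)$ $(n,m\in\mathbb N)$ of symbols of arity $n$ and coarity $m$, and a morphism is a family of functions $X(n,m)\to Y(n,m)$. Let $A$ be a set of labels and $\kappa$ a cardinal with $1\le\kappa$, $\kappa\cdot\kappa\le\kappa$ and $|A|\le\kappa$ (for instance any infinite $\kappa\ge|A|$). The behaviour functor $\mathcal F:\mathsf{Sig}\to\mathsf{Sig}$ sends $X$ to the signature $\mathcal FX$ for which $\mathcal FX(n,m)$ is the set of all sets, of cardinality at most $\kappa$, of transitions $(v,x,w)$ with $v\in A^n$, $x\in X(n,m)$, $w\in A^m$; it acts on morphisms by direct image on $x$. For an endofunctor $\mathcal S$ of $\mathsf{Sig}$ let $\mathcal S^\dagger$ be the free monad on it. A GSOS specification is a natural transformation $\mathcal S\mathcal F\Rightarrow\mathcal F\mathcal S^\dagger$. A distributive law of a monad $(\mathcal T,\eta,\mu)$ over $\mathcal F$ is a natural transformation $\lambda:\mathcal T\mathcal F\Rightarrow\mathcal F\mathcal T$ with $\lambda\circ\eta_{\mathcal F}=\mathcal F\eta$ and $\lambda\circ\mu_{\mathcal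 F}=\mathcal F\mu\circ\lambda_{\mathcal T}\circ\mathcal T\lambda$. Equations $\mathbb E=(\mathcal A,l,r)$ for $\mathcal T$ are an endofunctor $\mathcal A$ and natural transformations $l,r:\mathcal A\Rightarrow\mathcal T$; $q^{\mathbb E}:\mathcal T\to\mathcal T_{/\mathbb E}$ is the quotient monad; and $\lambda$ preserves $\mathbb E$ if $\mathcal Fq^{\mathbb E}\circ\lambda\circ l_{\mathcal F}=\mathcal Fq^{\mathbb E}\circ\lambda\circ r_{\mathcal F}$. Let $\mathcal S_{\mathrm{FR}}$ be the functor of the prop operations (sequential composition $;$, identity $id_1:1\to1$, parallel composition $\otimes$, its unit $id_0:0\to0$, symmetry $\sigma:2\to2$) together with four constants: comultiplication $\delta:1\to2$, counit $\epsilon:1\to0$, multiplication $\mu:2\to1$, unit $\eta:0\to1$. Let $\mathbb E_{\mathrm{Fr}}$ be the equations of special Frobenius bimonoids: $\delta$ is coassociative, cocommutative and counital, $\mu$ is associative, commutative and unital, $\delta;\mu=id_1$, and $(\delta\otimes id_1);(id_1\otimes\mu)=\mu;\delta=(id_1\otimes\delta);(\mu\otimes id_1)$. Let $\mathbb E_{\mathrm{CW}}$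 be $\mathbb E_{\mathrm{Fr}}$ together with the equations of symmetric strict monoidal categories, and let $\mathcal S_{\mathrm{CW}}=(\mathcal S_{\mathrm{FR}}^\dagger)_{/\mathbb E_{\mathrm{CW}}}$ be the monad of Carboni–Walters props. Write $c\xrightarrow[w]{v}c'$ for a transition $(v,c',w)$ of $c$. The prop GSOS specification is given by the rules - if $c\xrightarrow[b]{a}c'$ and $d\xrightarrow[e]{b}d'$ then $c;d\xrightarrow[e]{a}c';d'$; - if $c\xrightarrow[b_1]{a_1}c'$ and $d\xrightarrow[b_2]{a_2}d'$ then $c\otimes d\xrightarrow[b_1b_2]{a_1a_2}c'\otimes d'$; - $id_1\xrightarrow[k]{k}id_1$, $\ id_0\xrightarrow[\varepsilon]{\varepsilon}id_0$, $\ \sigma\xrightarrow[lk]{kl}\sigma$ for all $k,l\in A$. The *black* specification $\lambda_\bullet$ for $\mathcal S_{\mathrm{FR}}$ adds, for all $k\in A$, the rules $\delta\xrightarrow[kk]{k}\delta$, $\epsilon\xrightarrow[\varepsilon]{k}\epsilon$, $\mu\xrightarrow[k]{kk}\mu$, $\eta\xrightarrow[k]{\varepsilon}\eta$. If $A$ is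 an Abelian group, the *white* specification $\lambda_\circ$ adds instead, for all $k,l\in A$, the rules $\delta\xrightarrow[kl]{k+l}\delta$, $\epsilon\xrightarrow[\varepsilon]{0}\epsilon$, $\mu\xrightarrow[k+l]{kl}\mu$, $\eta\xrightarrow[0]{\varepsilon}\eta$. **Statement.** (Black.) There is a unique distributive law $\lambda_\bullet^\dagger:\mathcal S_{\mathrm{FR}}^\dagger\mathcal F\Rightarrow\mathcal F\mathcal S_{\mathrm{FR}}^\dagger$ that restricts to $\lambda_\bullet$ along $\mathcal S_{\mathrm{FR}}\Rightarrow\mathcal S_{\mathrm{FR}}^\dagger$. It preserves the equations $\mathbb E_{\mathrm{Fr}}$, and it preserves $\mathbb E_{\mathrm{CW}}$. There is a unique distributive law $\lambda_{\bullet/\mathrm{CW}}:\mathcal S_{\mathrm{CW}}\mathcal F\Rightarrow\mathcal F\mathcal S_{\mathrm{CW}}$ with $\lambda_{\bullet/\mathrm{CW}}\circ q\mathcal F=\mathcal Fq\circ\lambda_\bullet^\dagger$, where $q:\mathcal S_{\mathrm{FR}}^\dagger\to\mathcal S_{\mathrm{CW}}$ is the quotient map. (White.) If $A$ is an Abelian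 group, the same holds with $\lambda_\circ$ in place of $\lambda_\bullet$: there is a unique distributive law $\lambda_\circ^\dagger$ of $\mathcal S_{\mathrm{FR}}^\dagger$ over $\mathcal F$ that restricts to $\lambda_\circ$; it preserves $\mathbb E_{\mathrm{Fr}}$ and $\mathbb E_{\mathrm{CW}}$; and there is a unique distributive law $\lambda_{\circ/\mathrm{CW}}:\mathcal S_{\mathrm{CW}}\mathcal F\Rightarrow\mathcal F\mathcal S_{\mathrm{CW}}$ with $\lambda_{\circ/\mathrm{CW}}\circ q\mathcal F=\mathcal Fq\circ\lambda_\circ^\dagger$. -/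

import Mathlib

open CategoryTheory

universe u

namespace StringDiag

/-! ## Signatures -/

/-- The category `Sig` of signatures: sets of symbols with an arity and a coarity in `ℕ`, given
through their fibres, `X n m` being the set of symbols of arity `n` and coarity `m`. -/
def Sig : Type (u + 1) := ℕ → ℕ → Type u

namespace Sig

/-- Morphisms are functions that preserve arity and coarity. -/
instance : Category.{u} Sig.{u} where
  Hom X Y := ∀ n m : ℕ, X n m → Y n m
  id X := fun _ _ x => x
  comp f g := fun n m x => g n m (f n m x)

end Sig

/-! ## Distributive laws of a monad over an endofunctor -/

section Distributive

variable {C : Type*} [Category C]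

/-- A distributive law `TF ⇒ FT` of a monad `T` over an endofunctor `F`.
(Mathlib writes `F ⋙ T` for the composite `TF`.) -/
structure DistributiveLaw (T : Monad C) (F : C ⥤ C) where
  law : F ⋙ T.toFunctor ⟶ T.toFunctor ⋙ F
  unit_law : ∀ X : C, T.η.app (F.obj X) ≫ law.app X = F.map (T.η.app X)
  mul_law : ∀ X : C, T.μ.app (F.obj X) ≫ law.app X =
    T.map (law.app X) ≫ law.app (T.obj X) ≫ F.map (T.μ.app X)

end Distributive

/-! ## Syntax functors on `Sig` and their free monads -/

/-- A family of typed operations. An operation `o : Op n m` has arity `n` and coarity `m` and takes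
one argument, of arity `dom o a` and coarity `cod o a`, for every `a : Arg o`. -/
structure OpSig where
  Op : ℕ → ℕ → Type u
  Arg : {n m : ℕ} → Op n m → Type
  dom : {n m : ℕ} → (o : Op n m) → Arg o → ℕ
  cod : {n m : ℕ} → (o : Op n m) → Arg o → ℕ

namespace OpSig

/-- The endofunctor `S` of `Sig` of a family of operations: an element of `S X` is an operation
together with arguments taken from `X`. -/
def functor (C : OpSig.{u}) : Sig.{u} ⥤ Sig.{u} where
  obj X := fun n m => Σ o : C.Op n m, ∀ a : C.Arg o, X (C.dom o a) (C.cod o a)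
  map f := fun _ _ x => ⟨x.1, fun a => f _ _ (x.2 a)⟩

/-- Coproduct of families of operations; its functor is the coproduct of the functors. -/
def sum (C D : OpSig.{u}) : OpSig.{u} where
  Op n m := C.Op n m ⊕ D.Op n m
  Arg
    | Sum.inl o => C.Arg o
    | Sum.inr o => D.Arg o
  dom
    | Sum.inl o => C.dom o
    | Sum.inr o => D.dom o
  cod
    | Sum.inl o => C.cod o
    | Sum.inr o => D.cod o

end OpSig

/-- Terms over the signature `X`: the initial algebra of `X + S(-)`. -/
inductive Tm (C : OpSig.{u}) (X : Sig.{u}) : ℕ → ℕ → Type u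
  | var {n m : ℕ} (x : X n m) : Tm C X n m
  | op {n m : ℕ} (o : C.Op n m) (args : ∀ a : C.Arg o, Tm C X (C.dom o a) (C.cod o a)) :
      Tm C X n m

/-- The signature of terms over `X`. -/
abbrev TmSig (C : OpSig.{u}) (X : Sig.{u}) : Sig.{u} := Tm C X

namespace Tm

variable {C : OpSig.{u}} {X Y Z : Sig.{u}}

/-- Simultaneous substitution. -/
def bind (f : ∀ n m : ℕ, X n m → Tm C Y n m) : ∀ {n m : ℕ}, Tm C X n m → Tm C Y n m
  | _, _, var x => f _ _ x
  | _, _, op o args => op o (fun a => bind f (args a))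

/-- Renaming of variables. -/
def map (f : X ⟶ Y) {n m : ℕ} (t : Tm C X n m) : Tm C Y n m :=
  bind (fun n m x => var (f n m x)) t

/-- Flattening of terms over terms. -/
def join {n m : ℕ} (t : Tm C (TmSig C X) n m) : Tm C X n m :=
  bind (fun _ _ s => s) t

theorem bind_var {n m : ℕ} (t : Tm C X n m) : bind (fun _ _ x => var x) t = t := by
  induction t with
  | var x => rfl
  | op o args ih => simp only [bind, ih]

theorem bind_bind (f : ∀ n m : ℕ, X n m → Tm C Y n m) (g : ∀ n m : ℕ, Y n m → Tm C Z n m)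
    {n m : ℕ} (t : Tm C X n m) : bind g (bind f t) = bind (fun n m x => bind g (f n m x)) t := by
  induction t with
  | var x => rfl
  | op o args ih => simp only [bind, ih]

theorem map_map (f : X ⟶ Y) (g : Y ⟶ Z) {n m : ℕ} (t : Tm C X n m) :
    map g (map f t) = map (f ≫ g) t :=
  bind_bind (fun n m x => var (f n m x)) (fun n m x => var (g n m x)) t

theorem bind_join (f : ∀ n m : ℕ, X n m → Tm C Y n m) {n m : ℕ} (t : Tm C (TmSig C X) n m) :
    bind f (join t) = join (map (Y := TmSig C Y) (fun _ _ s => bind f s) t) :=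
  (bind_bind (X := TmSig C X) (fun _ _ s => s) f t).trans
    (bind_bind (X := TmSig C X) (Y := TmSig C Y) (fun _ _ s => var (bind f s)) (fun _ _ s => s) t).symm

theorem join_join {n m : ℕ} (t : Tm C (TmSig C (TmSig C X)) n m) :
    join (map (Y := TmSig C X) (fun _ _ s => join s) t) = join (join t) :=
  (bind_join (X := TmSig C X) (fun _ _ s => s) t).symm

theorem join_map_var {n m : ℕ} (t : Tm C X n m) :
    join (map (Y := TmSig C X) (fun _ _ x => var x) t) = t :=
  (bind_bind (Y := TmSig C X) (fun _ _ x => var (var x)) (fun _ _ s => s) t).trans (bind_var t)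

end Tm

/-- The free monad `S†` on the functor `S` of a family of operations. -/
def OpSig.free (C : OpSig.{u}) : Monad Sig.{u} where
  obj X := TmSig C X
  map f := fun _ _ t => Tm.map f t
  map_id X := by
    funext n m t
    exact Tm.bind_var t
  map_comp f g := by
    funext n m t
    exact (Tm.map_map f g t).symm
  η := { app := fun _ _ _ x => Tm.var x }
  μ :=
    { app := fun _ _ _ t => Tm.join t
      naturality := by
        intro X Y f
        funext n m t
        exact (Tm.bind_join (fun n m x => Tm.var (f n m x)) t).symm }
  assoc X := by
    funext n m t
    exact Tm.join_join t
  left_unit X := rfl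
  right_unit X := by
    funext n m t
    exact Tm.join_map_var t

/-- The canonical natural transformation `S ⇒ S†`. -/
def OpSig.toFree (C : OpSig.{u}) : C.functor ⟶ C.free.toFunctor where
  app _ := fun _ _ x => Tm.op x.1 (fun a => Tm.var (x.2 a))

/-- The inclusion of terms over `C` into terms over `C.sum D`. -/
def Tm.inl (D : OpSig.{u}) {C : OpSig.{u}} {X : Sig.{u}} :
    ∀ {n m : ℕ}, Tm C X n m → Tm (C.sum D) X n m
  | _, _, Tm.var x => Tm.var x
  | _, _, Tm.op o args => Tm.op (C := C.sum D) (Sum.inl o) (fun a => Tm.inl D (args a))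

/-- The inclusion of terms over `D` into terms over `C.sum D`. -/
def Tm.inr (C : OpSig.{u}) {D : OpSig.{u}} {X : Sig.{u}} :
    ∀ {n m : ℕ}, Tm D X n m → Tm (C.sum D) X n m
  | _, _, Tm.var x => Tm.var x
  | _, _, Tm.op o args => Tm.op (C := C.sum D) (Sum.inr o) (fun a => Tm.inr C (args a))

/-- The natural transformation `S₁† ⇒ (S₁ + S₂)†`. -/
def OpSig.inl (C D : OpSig.{u}) : C.free.toFunctor ⟶ (C.sum D).free.toFunctor where
  app _ := fun _ _ t => Tm.inl D t
  naturality := by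
    intro X Y f
    funext n m t
    change Tm.inl D (Tm.map f t) = Tm.map f (Tm.inl D t)
    induction t with
    | var x => rfl
    | op o args ih => exact congrArg (Tm.op (C := C.sum D) (Sum.inl o)) (funext ih)

/-- The natural transformation `S₂† ⇒ (S₁ + S₂)†`. -/
def OpSig.inr (C D : OpSig.{u}) : D.free.toFunctor ⟶ (C.sum D).free.toFunctor where
  app _ := fun _ _ t => Tm.inr C t
  naturality := by
    intro X Y f
    funext n m t
    change Tm.inr C (Tm.map f t) = Tm.map f (Tm.inr C t)
    induction t with
    | var x => rfl
    | op o args ih => exact congrArg (Tm.op (C := C.sum D) (Sum.inr o)) (funext ih)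

/-! ## Abstract GSOS specifications -/

/-- A GSOS specification `SF ⇒ FS†`. -/
abbrev GSOS (C : OpSig.{u}) (F : Sig.{u} ⥤ Sig.{u}) := F ⋙ C.functor ⟶ C.free.toFunctor ⋙ F

/-- The coproduct of two GSOS specifications: the copairing of `S₁F ⇒ FS₁† ⇒ F(S₁ + S₂)†` and
`S₂F ⇒ FS₂† ⇒ F(S₁ + S₂)†`. -/
def GSOS.coprod {C D : OpSig.{u}} {F : Sig.{u} ⥤ Sig.{u}} (r : GSOS C F) (s : GSOS D F) :
    GSOS (C.sum D) F where
  app X := fun n m x => match x with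
    | ⟨Sum.inl o, args⟩ => F.map ((OpSig.inl C D).app X) n m (r.app X n m ⟨o, args⟩)
    | ⟨Sum.inr o, args⟩ => F.map ((OpSig.inr C D).app X) n m (s.app X n m ⟨o, args⟩)
  naturality := by
    intro X Y f
    funext n m x
    rcases x with ⟨o | o, args⟩
    · have h := r.naturality f =≫ F.map ((OpSig.inl C D).app Y)
      simp only [Functor.comp_map, Category.assoc, ← F.map_comp, (OpSig.inl C D).naturality] at h
      simp only [F.map_comp] at h
      exact congrFun (congrFun (congrFun h n) m) ⟨o, args⟩
    · have h := s.naturality f =≫ F.map ((OpSig.inr C D).app Y)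
      simp only [Functor.comp_map, Category.assoc, ← F.map_comp, (OpSig.inr C D).naturality] at h
      simp only [F.map_comp] at h
      exact congrFun (congrFun (congrFun h n) m) ⟨o, args⟩

/-- The distributive law `l : S†F ⇒ FS†` is the one induced by the GSOS specification
`r : SF ⇒ FS†`, i.e. it restricts to `r` along `S ⇒ S†`. -/
def DistributiveLaw.Extends {C : OpSig.{u}} {F : Sig.{u} ⥤ Sig.{u}}
    (l : DistributiveLaw C.free F) (r : GSOS C F) : Prop :=
  ∀ X : Sig.{u}, C.toFree.app (F.obj X) ≫ l.law.app X = r.app X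

/-! ## Equations and quotients of free monads -/

/-- Equations for the monad `S†`: a functor of variables with natural left and right sides. -/
structure Equations (C : OpSig.{u}) where
  vars : Sig.{u} ⥤ Sig.{u}
  lhs : vars ⟶ C.free.toFunctor
  rhs : vars ⟶ C.free.toFunctor

namespace Equations

variable {C : OpSig.{u}}

/-- The union of two sets of equations. -/
def union (E E' : Equations C) : Equations C where
  vars :=
    { obj := fun X n m => E.vars.obj X n m ⊕ E'.vars.obj X n m
      map := fun f n m => Sum.map (E.vars.map f n m) (E'.vars.map f n m)
      map_id := by
        intro X
        funext n m x
        rcases x with x | x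
        · exact congrArg Sum.inl (congrFun (congrFun (congrFun (E.vars.map_id X) n) m) x)
        · exact congrArg Sum.inr (congrFun (congrFun (congrFun (E'.vars.map_id X) n) m) x)
      map_comp := by
        intro X Y Z f g
        funext n m x
        rcases x with x | x
        · exact congrArg Sum.inl (congrFun (congrFun (congrFun (E.vars.map_comp f g) n) m) x)
        · exact congrArg Sum.inr (congrFun (congrFun (congrFun (E'.vars.map_comp f g) n) m) x) }
  lhs :=
    { app := fun X n m => Sum.elim (E.lhs.app X n m) (E'.lhs.app X n m)
      naturality := by
        intro X Y f
        funext n m x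
        rcases x with x | x
        · exact congrFun (congrFun (congrFun (E.lhs.naturality f) n) m) x
        · exact congrFun (congrFun (congrFun (E'.lhs.naturality f) n) m) x }
  rhs :=
    { app := fun X n m => Sum.elim (E.rhs.app X n m) (E'.rhs.app X n m)
      naturality := by
        intro X Y f
        funext n m x
        rcases x with x | x
        · exact congrFun (congrFun (congrFun (E.rhs.naturality f) n) m) x
        · exact congrFun (congrFun (congrFun (E'.rhs.naturality f) n) m) x }

/-- Equations between terms over `C`, read as equations between terms over `C.sum D`. -/
def extend (E : Equations C) (D : OpSig.{u}) : Equations (C.sum D) where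
  vars := E.vars
  lhs := E.lhs ≫ OpSig.inl C D
  rhs := E.rhs ≫ OpSig.inl C D

/-- The least congruence on terms that contains all substitution instances of the equations. -/
inductive Cong (E : Equations C) (X : Sig.{u}) :
    ∀ {n m : ℕ}, Tm C X n m → Tm C X n m → Prop
  | eqn {n m : ℕ} (x : E.vars.obj (TmSig C X) n m) :
      Cong E X (Tm.join (E.lhs.app (TmSig C X) n m x)) (Tm.join (E.rhs.app (TmSig C X) n m x))
  | op {n m : ℕ} (o : C.Op n m) (s t : ∀ a : C.Arg o, Tm C X (C.dom o a) (C.cod o a))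
      (h : ∀ a, Cong E X (s a) (t a)) : Cong E X (Tm.op o s) (Tm.op o t)
  | refl {n m : ℕ} (t : Tm C X n m) : Cong E X t t
  | symm {n m : ℕ} {s t : Tm C X n m} (h : Cong E X s t) : Cong E X t s
  | trans {n m : ℕ} {s t r : Tm C X n m} (h : Cong E X s t) (h' : Cong E X t r) : Cong E X s r

/-- The congruence as a setoid. -/
def setoid (E : Equations C) (X : Sig.{u}) (n m : ℕ) : Setoid (Tm C X n m) where
  r := Cong E X
  iseqv := ⟨Cong.refl, Cong.symm, Cong.trans⟩

/-- Terms modulo the equations. -/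
def Quo (E : Equations C) (X : Sig.{u}) : Sig.{u} := fun n m => Quotient (E.setoid X n m)

/-- The class of a term. -/
def cls (E : Equations C) {X : Sig.{u}} {n m : ℕ} (t : Tm C X n m) : E.Quo X n m :=
  Quotient.mk (E.setoid X n m) t

theorem cls_eq (E : Equations C) {X : Sig.{u}} {n m : ℕ} {s t : Tm C X n m}
    (h : Cong E X s t) : E.cls s = E.cls t := Quotient.sound (s := E.setoid X n m) h

theorem cong_bind (E : Equations C) {X Y : Sig.{u}} (f : ∀ n m : ℕ, X n m → Tm C Y n m)
    {n m : ℕ} {s t : Tm C X n m} (h : Cong E X s t) :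
    Cong E Y (Tm.bind f s) (Tm.bind f t) := by
  induction h with
  | @eqn n m x =>
    have key (k : E.vars ⟶ C.free.toFunctor) :
        Tm.bind f (Tm.join (k.app (TmSig C X) n m x)) =
          Tm.join (k.app (TmSig C Y) n m (E.vars.map (Y := TmSig C Y)
            (fun _ _ t => Tm.bind f t) n m x)) := by
      have h := congrFun (congrFun (congrFun (k.naturality (X := TmSig C X) (Y := TmSig C Y)
            (fun _ _ t => Tm.bind f t)) n) m) x
      exact (Tm.bind_join f _).trans (congrArg Tm.join h).symm
    rw [key, key]
    exact Cong.eqn _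
  | op o s t _ ih => exact Cong.op o _ _ ih
  | refl t => exact Cong.refl _
  | symm _ ih => exact Cong.symm ih
  | trans _ _ ih ih' => exact Cong.trans ih ih'

theorem cong_of_forall (E : Equations C) {X Y : Sig.{u}} (f g : ∀ n m : ℕ, X n m → Tm C Y n m)
    (h : ∀ (n m : ℕ) (x : X n m), Cong E Y (f n m x) (g n m x)) {n m : ℕ} (t : Tm C X n m) :
    Cong E Y (Tm.bind f t) (Tm.bind g t) := by
  induction t with
  | var x => exact h _ _ x
  | op o args ih => exact Cong.op o _ _ ih

/-- The class map, as a morphism. -/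
def clsHom (E : Equations C) (X : Sig.{u}) : TmSig C X ⟶ E.Quo X := fun _ _ t => E.cls t

/-- Functoriality of the quotient. -/
def quoMap (E : Equations C) {X Y : Sig.{u}} (f : X ⟶ Y) : E.Quo X ⟶ E.Quo Y := fun n m =>
  Quotient.lift (s := E.setoid X n m) (fun t => E.cls (Tm.map f t))
    (fun _ _ h => E.cls_eq (E.cong_bind _ h))

/-- Flattening of classes of terms over classes of terms, through representatives. -/
noncomputable def quoJoin (E : Equations C) (X : Sig.{u}) : E.Quo (E.Quo X) ⟶ E.Quo X :=
  fun n m => Quotient.lift (s := E.setoid (E.Quo X) n m)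
    (fun t => E.cls (Tm.bind (fun n m x => Quotient.out (s := E.setoid X n m) x) t))
    (fun _ _ h => E.cls_eq (E.cong_bind _ h))

theorem cls_surj (E : Equations C) {X : Sig.{u}} {n m : ℕ} (x : E.Quo X n m) :
    ∃ t, E.cls t = x := Quotient.exists_rep (s := E.setoid X n m) x

theorem cong_out (E : Equations C) {X : Sig.{u}} {n m : ℕ} (t : Tm C X n m) :
    Cong E X (Quotient.out (s := E.setoid X n m) (E.cls t)) t :=
  Quotient.mk_out (s := E.setoid X n m) t

/-- Flattening does not depend on the representatives. -/
theorem quoJoin_cls (E : Equations C) {X : Sig.{u}} {n m : ℕ} (t : Tm C (TmSig C X) n m) :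
    E.quoJoin X n m (E.cls (Tm.map (E.clsHom X) t)) =
      E.cls (Tm.join t) := by
  refine E.cls_eq ?_
  refine (congrArg (Cong E X · _) (Tm.bind_bind (X := TmSig C X) _ _ t)).mpr ?_
  exact E.cong_of_forall (X := TmSig C X) _ _ (fun n m s => E.cong_out s) t

theorem lift_out (E : Equations C) {X : Sig.{u}} {n m : ℕ} (t : Tm C (E.Quo X) n m) :
    ∃ s : Tm C (TmSig C X) n m, Tm.map (E.clsHom X) s = t := by
  let w : E.Quo X ⟶ TmSig C X := fun n m x => Quotient.out (s := E.setoid X n m) x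
  have h : w ≫ E.clsHom X = 𝟙 _ := by
    funext n m x
    exact Quotient.out_eq (s := E.setoid X n m) x
  refine ⟨Tm.map w t, (Tm.map_map w _ t).trans ?_⟩
  rw [h]
  exact Tm.bind_var t

/-- The quotient of the monad `S†` by the equations. -/
noncomputable def quotient (E : Equations C) : Monad Sig.{u} where
  obj X := E.Quo X
  map f := E.quoMap f
  map_id X := by
    funext n m x
    obtain ⟨t, rfl⟩ := E.cls_surj x
    exact congrArg E.cls (Tm.bind_var t)
  map_comp f g := by
    funext n m x
    obtain ⟨t, rfl⟩ := E.cls_surj x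
    exact congrArg E.cls (Tm.map_map f g t).symm
  η := { app := fun X n m x => E.cls (Tm.var x) }
  μ :=
    { app := fun X => E.quoJoin X
      naturality := by
        intro X Y f
        funext n m x
        obtain ⟨t, rfl⟩ := E.cls_surj x
        obtain ⟨s, rfl⟩ := E.lift_out t
        have h : E.quoMap (E.quoMap f) n m (E.cls (Tm.map (E.clsHom X) s)) =
            E.cls (Tm.map (E.clsHom Y) (Tm.map (Y := TmSig C Y) (fun _ _ t => Tm.map f t) s)) :=
          congrArg E.cls ((Tm.map_map (E.clsHom X) (E.quoMap f) s).trans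
            (Tm.map_map (Y := TmSig C Y) (fun _ _ t => Tm.map f t) (E.clsHom Y) s).symm)
        refine (congrArg (E.quoJoin Y n m) h).trans ?_
        refine (E.quoJoin_cls _).trans ?_
        refine Eq.trans ?_ (congrArg (E.quoMap f n m) (E.quoJoin_cls s)).symm
        exact congrArg E.cls (Tm.bind_join (fun n m x => Tm.var (f n m x)) s).symm }
  assoc X := by
    funext n m x
    obtain ⟨t, rfl⟩ := E.cls_surj x
    obtain ⟨s, rfl⟩ := E.lift_out t
    let v : TmSig C (TmSig C X) ⟶ TmSig C (E.Quo X) := fun _ _ t => Tm.map (E.clsHom X) t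
    obtain ⟨r, rfl⟩ : ∃ r : Tm C (TmSig C (TmSig C X)) n m, Tm.map v r = s := by
      let w : TmSig C (E.Quo X) ⟶ TmSig C (TmSig C X) := fun n m t => (E.lift_out t).choose
      have h : w ≫ v = 𝟙 _ := by
        funext n m t
        exact (E.lift_out t).choose_spec
      refine ⟨Tm.map w s, (Tm.map_map w v s).trans ?_⟩
      rw [h]
      exact Tm.bind_var s
    let j : TmSig C (TmSig C X) ⟶ TmSig C X := fun _ _ t => Tm.join t
    have h1 : E.quoMap (E.quoJoin X) n m (E.cls (Tm.map (E.clsHom (E.Quo X)) (Tm.map v r))) =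
        E.cls (Tm.map (E.clsHom X) (Tm.map j r)) := by
      refine congrArg E.cls ?_
      refine (Tm.map_map (E.clsHom (E.Quo X)) (E.quoJoin X) _).trans ?_
      refine (Tm.map_map v _ r).trans (Eq.trans ?_ (Tm.map_map j _ r).symm)
      have h : v ≫ E.clsHom (E.Quo X) ≫ E.quoJoin X = j ≫ E.clsHom X := by
        funext n m t
        exact E.quoJoin_cls t
      rw [h]
    have h2 : E.quoJoin (E.Quo X) n m (E.cls (Tm.map (E.clsHom (E.Quo X)) (Tm.map v r))) =
        E.cls (Tm.map (E.clsHom X) (Tm.join r)) :=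
      (E.quoJoin_cls _).trans
        (congrArg E.cls (Tm.bind_join (fun n m x => Tm.var (E.clsHom X n m x)) r).symm)
    refine (congrArg (E.quoJoin X n m) h1).trans ?_
    refine Eq.trans ?_ (congrArg (E.quoJoin X n m) h2).symm
    refine (E.quoJoin_cls _).trans (Eq.trans ?_ (E.quoJoin_cls _).symm)
    exact congrArg E.cls (Tm.join_join r)
  left_unit X := by
    funext n m x
    exact Quotient.out_eq (s := E.setoid X n m) x
  right_unit X := by
    funext n m x
    obtain ⟨t, rfl⟩ := E.cls_surj x
    let v : X ⟶ TmSig C X := fun _ _ x => Tm.var x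
    have h : E.quoMap (v ≫ E.clsHom X) n m (E.cls t) =
        E.cls (Tm.map (E.clsHom X) (Tm.map v t)) :=
      congrArg E.cls (Tm.map_map v (E.clsHom X) t).symm
    refine (congrArg (E.quoJoin X n m) h).trans ((E.quoJoin_cls _).trans ?_)
    exact congrArg E.cls (Tm.join_map_var t)

/-- The quotient map `S† ⇒ S†/E`, a morphism of monads. -/
noncomputable def proj (E : Equations C) : MonadHom C.free E.quotient where
  app X := fun _ _ t => E.cls t
  naturality _ _ _ := rfl
  app_η _ := rfl
  app_μ X := by
    funext n m t
    exact (E.quoJoin_cls t).symm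

end Equations

/-- The distributive law `l` over `S†` preserves the equations `E`. -/
def DistributiveLaw.Preserves {C : OpSig.{u}} {F : Sig.{u} ⥤ Sig.{u}}
    (l : DistributiveLaw C.free F) (E : Equations C) : Prop :=
  ∀ X : Sig.{u}, E.lhs.app (F.obj X) ≫ l.law.app X ≫ F.map (E.proj.app X) =
    E.rhs.app (F.obj X) ≫ l.law.app X ≫ F.map (E.proj.app X)

/-- The distributive law `k` over `S†/E` is a quotient of the distributive law `l` over `S†`. -/
def DistributiveLaw.IsQuotientOf {C : OpSig.{u}} {F : Sig.{u} ⥤ Sig.{u}} {E : Equations C}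
    (k : DistributiveLaw E.quotient F) (l : DistributiveLaw C.free F) : Prop :=
  ∀ X : Sig.{u}, E.proj.app (F.obj X) ≫ k.law.app X = l.law.app X ≫ F.map (E.proj.app X)

/-! ## Props -/

/-- The operations of props: sequential composition, the identity on `1`, parallel composition,
its unit, and the symmetry on `1 + 1`. -/
inductive SMOp : ℕ → ℕ → Type u
  | seq (n z m : ℕ) : SMOp n m
  | idn : SMOp 1 1
  | par (n₁ m₁ n₂ m₂ : ℕ) {n m : ℕ} (hn : n₁ + n₂ = n) (hm : m₁ + m₂ = m) : SMOp n m
  | unit : SMOp 0 0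
  | sym : SMOp 2 2

/-- The functor `S_SM = (Id ; Id) + ι + (Id ⊕ Id) + ε + σ`. The two arguments of the binary
operations are indexed by `false` (first) and `true` (second). -/
def SM : OpSig.{u} where
  Op := SMOp
  Arg
    | SMOp.seq _ _ _ => Bool
    | SMOp.par _ _ _ _ _ _ => Bool
    | _ => Empty
  dom
    | SMOp.seq n z _ => fun a => match a with
      | false => n
      | true => z
    | SMOp.par n₁ _ n₂ _ _ _ => fun a => match a with
      | false => n₁
      | true => n₂
    | SMOp.idn => Empty.elim
    | SMOp.unit => Empty.elim
    | SMOp.sym => Empty.elim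
  cod
    | SMOp.seq _ z m => fun a => match a with
      | false => z
      | true => m
    | SMOp.par _ m₁ _ m₂ _ _ => fun a => match a with
      | false => m₁
      | true => m₂
    | SMOp.idn => Empty.elim
    | SMOp.unit => Empty.elim
    | SMOp.sym => Empty.elim

namespace SM

variable {X : Sig.{u}}

/-- Sequential composition `s ; t`. -/
def seq {n z m : ℕ} (s : Tm SM X n z) (t : Tm SM X z m) : Tm SM X n m :=
  Tm.op (C := SM) (SMOp.seq n z m) (fun a => match a with
    | false => s
    | true => t)

/-- Parallel composition `s ⊕ t`. -/
def par {n₁ m₁ n₂ m₂ n m : ℕ} (hn : n₁ + n₂ = n) (hm : m₁ + m₂ = m)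
    (s : Tm SM X n₁ m₁) (t : Tm SM X n₂ m₂) : Tm SM X n m :=
  Tm.op (C := SM) (SMOp.par n₁ m₁ n₂ m₂ hn hm) (fun a => match a with
    | false => s
    | true => t)

/-- The identity on `1`. -/
def id1 : Tm SM X 1 1 := Tm.op (C := SM) SMOp.idn (fun a => Empty.elim a)

/-- The identity on `0`. -/
def unit : Tm SM X 0 0 := Tm.op (C := SM) SMOp.unit (fun a => Empty.elim a)

/-- The basic symmetry. -/
def sym : Tm SM X 2 2 := Tm.op (C := SM) SMOp.sym (fun a => Empty.elim a)

/-- The identity on `n`. -/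
def idN : (n : ℕ) → Tm SM X n n
  | 0 => unit
  | n + 1 => par rfl rfl (idN n) id1

/-- The symmetry `1 + n → n + 1`. -/
def sym1N : (n : ℕ) → Tm SM X (1 + n) (n + 1)
  | 0 => id1
  | n + 1 => seq (z := n + 2) (par (m₁ := n + 1) (Nat.add_assoc 1 n 1) rfl (sym1N n) id1)
      (par (n₂ := 2) (m₂ := 2) rfl rfl (idN n) sym)

/-- The symmetry `n + 1 → 1 + n`. -/
def symN1 : (n : ℕ) → Tm SM X (n + 1) (1 + n)
  | 0 => id1
  | n + 1 => seq (z := n + 2) (par (n₂ := 2) (m₂ := 2) rfl rfl (idN n) sym)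
      (par (n₁ := n + 1) rfl (Nat.add_assoc 1 n 1) (symN1 n) id1)

/-- The variables of the equations of symmetric strict monoidal categories. -/
inductive EqVars (X : Sig.{u}) : ℕ → ℕ → Type u
  | parAssoc {n₁ m₁ n₂ m₂ n₃ m₃ : ℕ} (f : X n₁ m₁) (g : X n₂ m₂) (h : X n₃ m₃) :
      EqVars X (n₁ + n₂ + n₃) (m₁ + m₂ + m₃)
  | parUnitLeft {n m : ℕ} (f : X n m) : EqVars X n m
  | parUnitRight {n m : ℕ} (f : X n m) : EqVars X n m
  | symSym : EqVars X 2 2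
  | interchange {n₁ z₁ m₁ n₂ z₂ m₂ : ℕ}
      (f : X n₁ z₁) (g : X z₁ m₁) (h : X n₂ z₂) (i : X z₂ m₂) : EqVars X (n₁ + n₂) (m₁ + m₂)
  | seqAssoc {n w v m : ℕ} (f : X n w) (g : X w v) (h : X v m) : EqVars X n m
  | seqIdRight {n m : ℕ} (f : X n m) : EqVars X n m
  | seqIdLeft {n m : ℕ} (f : X n m) : EqVars X n m
  | symNatLeft {n m : ℕ} (f : X n m) : EqVars X (1 + n) (m + 1)
  | symNatRight {n m : ℕ} (f : X n m) : EqVars X (n + 1) (1 + m)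

/-- The functor of variables. -/
def eqVars : Sig.{u} ⥤ Sig.{u} where
  obj X := EqVars X
  map u := fun _ _ x => match x with
    | .parAssoc f g h => .parAssoc (u _ _ f) (u _ _ g) (u _ _ h)
    | .parUnitLeft f => .parUnitLeft (u _ _ f)
    | .parUnitRight f => .parUnitRight (u _ _ f)
    | .symSym => .symSym
    | .interchange f g h i => .interchange (u _ _ f) (u _ _ g) (u _ _ h) (u _ _ i)
    | .seqAssoc f g h => .seqAssoc (u _ _ f) (u _ _ g) (u _ _ h)
    | .seqIdRight f => .seqIdRight (u _ _ f)
    | .seqIdLeft f => .seqIdLeft (u _ _ f)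
    | .symNatLeft f => .symNatLeft (u _ _ f)
    | .symNatRight f => .symNatRight (u _ _ f)
  map_id X := by
    funext n m x
    cases x <;> rfl
  map_comp f g := by
    funext n m x
    cases x <;> rfl

/-- The left-hand sides. -/
def lhs : ∀ {n m : ℕ}, EqVars X n m → Tm SM X n m
  | _, _, .parAssoc f g h => par rfl rfl (par rfl rfl (.var f) (.var g)) (.var h)
  | _, _, .parUnitLeft f => par (Nat.zero_add _) (Nat.zero_add _) unit (.var f)
  | _, _, .parUnitRight f => par rfl rfl (.var f) unit
  | _, _, .symSym => seq sym sym
  | _, _, .interchange f g h i => par rfl rfl (seq (.var f) (.var g)) (seq (.var h) (.var i))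
  | _, _, .seqAssoc f g h => seq (seq (.var f) (.var g)) (.var h)
  | _, _, .seqIdRight f => seq (.var f) (idN _)
  | _, _, .seqIdLeft f => seq (idN _) (.var f)
  | _, _, .symNatLeft f => seq (sym1N _) (par rfl rfl (.var f) id1)
  | _, _, .symNatRight f => seq (symN1 _) (par rfl rfl id1 (.var f))

/-- The right-hand sides. -/
def rhs : ∀ {n m : ℕ}, EqVars X n m → Tm SM X n m
  | _, _, .parAssoc f g h =>
      par (Nat.add_assoc _ _ _).symm (Nat.add_assoc _ _ _).symm (.var f)
        (par rfl rfl (.var g) (.var h))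
  | _, _, .parUnitLeft f => .var f
  | _, _, .parUnitRight f => .var f
  | _, _, .symSym => idN 2
  | _, _, .interchange f g h i => seq (par rfl rfl (.var f) (.var h)) (par rfl rfl (.var g) (.var i))
  | _, _, .seqAssoc f g h => seq (.var f) (seq (.var g) (.var h))
  | _, _, .seqIdRight f => .var f
  | _, _, .seqIdLeft f => .var f
  | _, _, .symNatLeft f => seq (par rfl rfl id1 (.var f)) (sym1N _)
  | _, _, .symNatRight f => seq (par rfl rfl (.var f) id1) (symN1 _)

variable {Y : Sig.{u}} (u : X ⟶ Y)

theorem map_seq {n z m : ℕ} (s : Tm SM X n z) (t : Tm SM X z m) :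
    Tm.map u (seq s t) = seq (Tm.map u s) (Tm.map u t) := by
  refine congrArg (Tm.op (C := SM) (SMOp.seq n z m)) ?_
  funext a
  cases a <;> rfl

theorem map_par {n₁ m₁ n₂ m₂ n m : ℕ} (hn : n₁ + n₂ = n) (hm : m₁ + m₂ = m)
    (s : Tm SM X n₁ m₁) (t : Tm SM X n₂ m₂) :
    Tm.map u (par hn hm s t) = par hn hm (Tm.map u s) (Tm.map u t) := by
  refine congrArg (Tm.op (C := SM) (SMOp.par n₁ m₁ n₂ m₂ hn hm)) ?_
  funext a
  cases a <;> rfl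

theorem map_var {n m : ℕ} (x : X n m) :
    Tm.map u (Tm.var (C := SM) x) = Tm.var (u n m x) := rfl

theorem map_id1 : Tm.map u (id1 : Tm SM X 1 1) = id1 := by
  refine congrArg (Tm.op (C := SM) SMOp.idn) ?_
  funext a
  exact Empty.elim a

theorem map_unit : Tm.map u (unit : Tm SM X 0 0) = unit := by
  refine congrArg (Tm.op (C := SM) SMOp.unit) ?_
  funext a
  exact Empty.elim a

theorem map_sym : Tm.map u (sym : Tm SM X 2 2) = sym := by
  refine congrArg (Tm.op (C := SM) SMOp.sym) ?_
  funext a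
  exact Empty.elim a

theorem map_idN (n : ℕ) : Tm.map u (idN n : Tm SM X n n) = idN n := by
  induction n with
  | zero => exact map_unit u
  | succ n ih => simp only [idN, map_par, ih, map_id1]

theorem map_sym1N (n : ℕ) : Tm.map u (sym1N n : Tm SM X (1 + n) (n + 1)) = sym1N n := by
  induction n with
  | zero => exact map_id1 u
  | succ n ih => simp only [sym1N, map_seq, map_par, ih, map_id1, map_idN, map_sym]

theorem map_symN1 (n : ℕ) : Tm.map u (symN1 n : Tm SM X (n + 1) (1 + n)) = symN1 n := by
  induction n with
  | zero => exact map_id1 u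
  | succ n ih => simp only [symN1, map_seq, map_par, ih, map_id1, map_idN, map_sym]

/-- The equations of symmetric strict monoidal categories. -/
def equations : Equations SM.{u} where
  vars := eqVars
  lhs :=
    { app := fun X _ _ x => lhs x
      naturality := by
        intro X Y u
        funext n m x
        change lhs (eqVars.map u n m x) = Tm.map u (lhs x)
        cases x <;> simp only [lhs, eqVars, map_seq, map_par, map_var, map_id1, map_unit, map_sym,
          map_idN, map_sym1N, map_symN1] }
  rhs :=
    { app := fun X _ _ x => rhs x
      naturality := by
        intro X Y u
        funext n m x
        change rhs (eqVars.map u n m x) = Tm.map u (rhs x)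
        cases x <;> simp only [rhs, eqVars, map_seq, map_par, map_var, map_id1, map_idN, map_sym1N,
          map_symN1] }

end SM

/-! ## Carboni-Walters props -/

/-- The generators of a Frobenius bimonoid. -/
inductive FrobOp : ℕ → ℕ → Type u
  | comult : FrobOp 1 2
  | counit : FrobOp 1 0
  | mult : FrobOp 2 1
  | unit : FrobOp 0 1

/-- The four constant functors given by the generators. -/
def Frob : OpSig.{u} where
  Op := FrobOp
  Arg _ := Empty
  dom _ := Empty.elim
  cod _ := Empty.elim

/-- The functor `S_FR`: the operations of props and the Frobenius generators. -/
def FR : OpSig.{u} := SM.sum Frob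

namespace FR

variable {X : Sig.{u}}

/-- Sequential composition `s ; t`. -/
def seq {n z m : ℕ} (s : Tm FR X n z) (t : Tm FR X z m) : Tm FR X n m :=
  Tm.op (C := FR) (Sum.inl (SMOp.seq n z m)) (fun a => match a with
    | false => s
    | true => t)

/-- Parallel composition `s ⊕ t`. -/
def par {n₁ m₁ n₂ m₂ n m : ℕ} (hn : n₁ + n₂ = n) (hm : m₁ + m₂ = m)
    (s : Tm FR X n₁ m₁) (t : Tm FR X n₂ m₂) : Tm FR X n m :=
  Tm.op (C := FR) (Sum.inl (SMOp.par n₁ m₁ n₂ m₂ hn hm)) (fun a => match a with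
    | false => s
    | true => t)

/-- The identity on `1`. -/
def id1 : Tm FR X 1 1 := Tm.op (C := FR) (Sum.inl SMOp.idn) (fun a => Empty.elim a)

/-- The basic symmetry. -/
def sym : Tm FR X 2 2 := Tm.op (C := FR) (Sum.inl SMOp.sym) (fun a => Empty.elim a)

/-- A Frobenius generator. -/
def gen {n m : ℕ} (g : FrobOp n m) : Tm FR X n m :=
  Tm.op (C := FR) (Sum.inr g) (fun a => Empty.elim a)

/-- The comultiplication. -/
def comult : Tm FR X 1 2 := gen FrobOp.comult

/-- The counit. -/
def counit : Tm FR X 1 0 := gen FrobOp.counit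

/-- The multiplication. -/
def mult : Tm FR X 2 1 := gen FrobOp.mult

/-- The unit. -/
def unit : Tm FR X 0 1 := gen FrobOp.unit

/-- Names of the equations of special Frobenius bimonoids, with their arity and coarity. -/
inductive EqName : ℕ → ℕ → Type u
  | coassoc : EqName 1 3
  | cocomm : EqName 1 2
  | counitLeft : EqName 1 1
  | assoc : EqName 3 1
  | comm : EqName 2 1
  | unitLeft : EqName 1 1
  | special : EqName 1 1
  | frobLeft : EqName 2 2
  | frobRight : EqName 2 2

/-- The left-hand sides. -/
def lhs : ∀ {n m : ℕ}, EqName.{u} n m → Tm FR X n m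
  | _, _, .coassoc => seq comult (par rfl rfl comult id1)
  | _, _, .cocomm => seq comult sym
  | _, _, .counitLeft => seq comult (par rfl rfl counit id1)
  | _, _, .assoc => seq (par rfl rfl mult id1) mult
  | _, _, .comm => seq sym mult
  | _, _, .unitLeft => seq (par rfl rfl unit id1) mult
  | _, _, .special => seq comult mult
  | _, _, .frobLeft => seq (z := 3) (par rfl rfl comult id1) (par rfl rfl id1 mult)
  | _, _, .frobRight => seq (z := 3) (par rfl rfl id1 comult) (par rfl rfl mult id1)

/-- The right-hand sides. -/
def rhs : ∀ {n m : ℕ}, EqName.{u} n m → Tm FR X n m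
  | _, _, .coassoc => seq comult (par rfl rfl id1 comult)
  | _, _, .cocomm => comult
  | _, _, .counitLeft => id1
  | _, _, .assoc => seq (par rfl rfl id1 mult) mult
  | _, _, .comm => mult
  | _, _, .unitLeft => id1
  | _, _, .special => id1
  | _, _, .frobLeft => seq mult comult
  | _, _, .frobRight => seq mult comult

variable {Y : Sig.{u}} (u : X ⟶ Y)

theorem map_seq {n z m : ℕ} (s : Tm FR X n z) (t : Tm FR X z m) :
    Tm.map u (seq s t) = seq (Tm.map u s) (Tm.map u t) := by
  refine congrArg (Tm.op (C := FR) (Sum.inl (SMOp.seq n z m))) ?_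
  funext a
  cases a <;> rfl

theorem map_par {n₁ m₁ n₂ m₂ n m : ℕ} (hn : n₁ + n₂ = n) (hm : m₁ + m₂ = m)
    (s : Tm FR X n₁ m₁) (t : Tm FR X n₂ m₂) :
    Tm.map u (par hn hm s t) = par hn hm (Tm.map u s) (Tm.map u t) := by
  refine congrArg (Tm.op (C := FR) (Sum.inl (SMOp.par n₁ m₁ n₂ m₂ hn hm))) ?_
  funext a
  cases a <;> rfl

theorem map_id1 : Tm.map u (id1 : Tm FR X 1 1) = id1 := by
  refine congrArg (Tm.op (C := FR) (Sum.inl SMOp.idn)) ?_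
  funext a
  exact Empty.elim a

theorem map_sym : Tm.map u (sym : Tm FR X 2 2) = sym := by
  refine congrArg (Tm.op (C := FR) (Sum.inl SMOp.sym)) ?_
  funext a
  exact Empty.elim a

theorem map_gen {n m : ℕ} (g : FrobOp n m) : Tm.map u (gen g : Tm FR X n m) = gen g := by
  refine congrArg (Tm.op (C := FR) (Sum.inr g)) ?_
  funext a
  exact Empty.elim a

/-- The equations of special Frobenius bimonoids. -/
def frobEquations : Equations FR.{u} where
  vars :=
    { obj := fun _ => EqName
      map := fun _ _ _ e => e }
  lhs :=
    { app := fun X _ _ e => lhs e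
      naturality := by
        intro X Y u
        funext n m e
        change lhs e = Tm.map u (lhs e)
        cases e <;> simp only [lhs, comult, counit, mult, unit, map_seq, map_par, map_id1, map_sym,
          map_gen] }
  rhs :=
    { app := fun X _ _ e => rhs e
      naturality := by
        intro X Y u
        funext n m e
        change rhs e = Tm.map u (rhs e)
        cases e <;> simp only [rhs, comult, mult, map_seq, map_par, map_id1, map_gen] }

/-- The equations of Carboni-Walters props: those of symmetric strict monoidal categories and those
of special Frobenius bimonoids. -/
def cwEquations : Equations FR.{u} := (SM.equations.extend Frob).union frobEquations

end FR

/-- The monad `S_CW`, whose algebras are the Carboni-Walters props. -/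
noncomputable abbrev CWMonad : Monad Sig.{u} := FR.cwEquations.quotient

/-! ## The behaviour functor -/

/-- Words of length `n`. -/
abbrev Word (A : Type u) (n : ℕ) := List.Vector A n

/-- Elements of `(L ; X ; L) n m`: triples of a word of length `n`, an element of `X n m`, and a
word of length `m`. -/
@[ext]
structure Transition (A : Type u) (X : Sig.{u}) (n m : ℕ) : Type u where
  left : Word A n
  target : X n m
  right : Word A m

/-- The action of a morphism on the target of a transition. -/
def Transition.map {A : Type u} {X Y : Sig.{u}} (f : X ⟶ Y) {n m : ℕ} (τ : Transition A X n m) :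
    Transition A Y n m := ⟨τ.left, f n m τ.target, τ.right⟩

/-- The behaviour functor `F X = P(L ; X ; L)`, where `P` takes the subsets of cardinality at
most `κ`. -/
def Beh (A : Type u) (κ : Cardinal.{u}) : Sig.{u} ⥤ Sig.{u} where
  obj X := fun n m => {U : Set (Transition A X n m) // Cardinal.mk U ≤ κ}
  map f := fun _ _ U => ⟨Transition.map f '' U.1, Cardinal.mk_image_le.trans U.2⟩
  map_id X := by
    funext n m U
    exact Subtype.ext (Set.image_id U.1)
  map_comp f g := by
    funext n m U
    exact Subtype.ext (Set.image_comp (Transition.map g) (Transition.map f) U.1)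

/-- The bound `κ` is large enough for the rules to define sets of at most `κ` transitions. -/
structure Bound (A : Type u) (κ : Cardinal.{u}) : Prop where
  one_le : 1 ≤ κ
  mul_self_le : κ * κ ≤ κ
  labels_le : Cardinal.mk A ≤ κ

namespace Bound

variable {A : Type u} {κ : Cardinal.{u}}

theorem range_one (hκ : Bound A κ) {β : Type u} (f : A → β) : Cardinal.mk (Set.range f) ≤ κ :=
  Cardinal.mk_range_le.trans hκ.labels_le

theorem range_two (hκ : Bound A κ) {β : Type u} (f : A × A → β) :
    Cardinal.mk (Set.range f) ≤ κ := by
  refine Cardinal.mk_range_le.trans ?_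
  rw [Cardinal.mk_prod]
  simp only [Cardinal.lift_id]
  exact (mul_le_mul' hκ.labels_le hκ.labels_le).trans hκ.mul_self_le

theorem singleton (hκ : Bound A κ) {β : Type u} (b : β) : Cardinal.mk ({b} : Set β) ≤ κ := by
  rw [Cardinal.mk_singleton]
  exact hκ.one_le

theorem pairs (hκ : Bound A κ) {α β γ : Type u} {U : Set α} {V : Set β} (hU : Cardinal.mk U ≤ κ)
    (hV : Cardinal.mk V ≤ κ) (p : α → β → Prop) (f : α → β → γ) :
    Cardinal.mk {c : γ | ∃ a ∈ U, ∃ b ∈ V, p a b ∧ c = f a b} ≤ κ := by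
  have h : {c : γ | ∃ a ∈ U, ∃ b ∈ V, p a b ∧ c = f a b} ⊆
      Set.range (fun x : U × V => f x.1.1 x.2.1) := by
    rintro c ⟨a, ha, b, hb, -, rfl⟩
    exact ⟨(⟨a, ha⟩, ⟨b, hb⟩), rfl⟩
  refine (Cardinal.mk_le_mk_of_subset h).trans (Cardinal.mk_range_le.trans ?_)
  rw [Cardinal.mk_prod]
  simp only [Cardinal.lift_id]
  exact (mul_le_mul' hU hV).trans hκ.mul_self_le

end Bound

/-- Concatenation of words. -/
def Word.append {A : Type u} {n₁ n₂ n : ℕ} (h : n₁ + n₂ = n) (v : Word A n₁) (w : Word A n₂) :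
    Word A n := ⟨v.1 ++ w.1, by rw [List.length_append, v.2, w.2, h]⟩

/-! ## The GSOS specifications -/

section Rules

variable {A : Type u} {κ : Cardinal.{u}}

/-- The transitions that the structural rules give to the operations of props. -/
def smRules (hκ : Bound A κ) (X : Sig.{u}) : ∀ {n m : ℕ} (o : SMOp n m),
    (∀ a : SM.Arg o, (Beh A κ).obj X (SM.dom o a) (SM.cod o a)) → (Beh A κ).obj (TmSig SM X) n m
  | _, _, SMOp.seq _ z _, U =>
      ⟨{τ | ∃ ρ ∈ (U false).1, ∃ σ ∈ (U true).1, ρ.right = σ.left ∧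
          τ = ⟨ρ.left, SM.seq (z := z) (Tm.var ρ.target) (Tm.var σ.target), σ.right⟩},
        hκ.pairs (U false).2 (U true).2 _ _⟩
  | _, _, SMOp.idn, _ =>
      ⟨Set.range fun k : A => ⟨⟨[k], rfl⟩, SM.id1, ⟨[k], rfl⟩⟩, hκ.range_one _⟩
  | _, _, SMOp.par _ _ _ _ hn hm, U =>
      ⟨{τ | ∃ ρ ∈ (U false).1, ∃ σ ∈ (U true).1, True ∧
          τ = ⟨Word.append hn ρ.left σ.left,
            SM.par hn hm (Tm.var ρ.target) (Tm.var σ.target),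
            Word.append hm ρ.right σ.right⟩},
        hκ.pairs (U false).2 (U true).2 _ _⟩
  | _, _, SMOp.unit, _ => ⟨{⟨⟨[], rfl⟩, SM.unit, ⟨[], rfl⟩⟩}, hκ.singleton _⟩
  | _, _, SMOp.sym, _ =>
      ⟨Set.range fun k : A × A => ⟨⟨[k.1, k.2], rfl⟩, SM.sym, ⟨[k.2, k.1], rfl⟩⟩, hκ.range_two _⟩

/-- The GSOS specification for props. -/
def smGSOS (hκ : Bound A κ) : GSOS SM (Beh A κ) where
  app X := fun _ _ x => smRules hκ X x.1 x.2
  naturality := by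
    intro X Y f
    funext n m x
    rcases x with ⟨o, U⟩
    apply Subtype.ext
    change (smRules hκ Y o (fun a => (Beh A κ).map f _ _ (U a))).1 =
      Transition.map (X := TmSig SM X) (Y := TmSig SM Y) (fun _ _ t => Tm.map f t) ''
        (smRules hκ X o U).1
    cases o with
    | seq n z m =>
      ext τ
      constructor
      · rintro ⟨_, ⟨ρ, hρ, rfl⟩, _, ⟨σ, hσ, rfl⟩, h, rfl⟩
        exact ⟨_, ⟨ρ, hρ, σ, hσ, h, rfl⟩, Transition.ext rfl (SM.map_seq f _ _) rfl⟩
      · rintro ⟨_, ⟨ρ, hρ, σ, hσ, h, rfl⟩, rfl⟩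
        exact ⟨_, ⟨ρ, hρ, rfl⟩, _, ⟨σ, hσ, rfl⟩, h, Transition.ext rfl (SM.map_seq f _ _) rfl⟩
    | idn =>
      refine Eq.trans ?_ (Set.range_comp _ _)
      exact congrArg Set.range (funext fun k => Transition.ext rfl (SM.map_id1 f).symm rfl)
    | par n₁ m₁ n₂ m₂ hn hm =>
      ext τ
      constructor
      · rintro ⟨_, ⟨ρ, hρ, rfl⟩, _, ⟨σ, hσ, rfl⟩, -, rfl⟩
        exact ⟨_, ⟨ρ, hρ, σ, hσ, trivial, rfl⟩, Transition.ext rfl (SM.map_par f _ _ _ _) rfl⟩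
      · rintro ⟨_, ⟨ρ, hρ, σ, hσ, h, rfl⟩, rfl⟩
        exact ⟨_, ⟨ρ, hρ, rfl⟩, _, ⟨σ, hσ, rfl⟩, trivial,
          Transition.ext rfl (SM.map_par f _ _ _ _) rfl⟩
    | unit =>
      refine Eq.trans ?_ Set.image_singleton.symm
      refine congrArg (fun t => {(⟨⟨[], rfl⟩, t, ⟨[], rfl⟩⟩ : Transition A (TmSig SM Y) 0 0)}) ?_
      exact (SM.map_unit f).symm
    | sym =>
      refine Eq.trans ?_ (Set.range_comp _ _)
      exact congrArg Set.range (funext fun k => Transition.ext rfl (SM.map_sym f).symm rfl)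

/-- A Frobenius generator as a term. -/
def Frob.gen {X : Sig.{u}} {n m : ℕ} (g : FrobOp n m) : Tm Frob X n m :=
  Tm.op (C := Frob) g (fun a => Empty.elim a)

theorem Frob.map_gen {X Y : Sig.{u}} (f : X ⟶ Y) {n m : ℕ} (g : FrobOp n m) :
    Tm.map f (Frob.gen g) = Frob.gen g := by
  refine congrArg (Tm.op (C := Frob) g) ?_
  funext a
  exact Empty.elim a

/-- The GSOS specification in which every Frobenius generator `g` has the transitions to itself
whose labels are in `R g`. -/
def genGSOS (R : ∀ {n m : ℕ}, FrobOp.{u} n m → Set (Word A n × Word A m))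
    (hR : ∀ {n m : ℕ} (g : FrobOp n m), Cardinal.mk (R g) ≤ κ) : GSOS Frob (Beh A κ) where
  app X := fun _ _ x =>
    ⟨(fun l => ⟨l.1, Frob.gen x.1, l.2⟩) '' R x.1, Cardinal.mk_image_le.trans (hR x.1)⟩
  naturality := by
    intro X Y f
    funext n m x
    apply Subtype.ext
    refine Eq.trans ?_ (Set.image_image _ _ _).symm
    exact congrArg (· '' R x.1)
      (funext fun l => Transition.ext rfl (Frob.map_gen f x.1).symm rfl)

/-- The labels of the black generators: synchronisation of labels. -/
def blackLabels (A : Type u) : ∀ {n m : ℕ}, FrobOp.{u} n m → Set (Word A n × Word A m)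
  | _, _, .comult => Set.range fun k : A => (⟨[k], rfl⟩, ⟨[k, k], rfl⟩)
  | _, _, .counit => Set.range fun k : A => (⟨[k], rfl⟩, ⟨[], rfl⟩)
  | _, _, .mult => Set.range fun k : A => (⟨[k, k], rfl⟩, ⟨[k], rfl⟩)
  | _, _, .unit => Set.range fun k : A => (⟨[], rfl⟩, ⟨[k], rfl⟩)

/-- The labels of the white generators: addition of labels. -/
def whiteLabels (A : Type u) [AddCommGroup A] :
    ∀ {n m : ℕ}, FrobOp.{u} n m → Set (Word A n × Word A m)
  | _, _, .comult => Set.range fun k : A × A => (⟨[k.1 + k.2], rfl⟩, ⟨[k.1, k.2], rfl⟩)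
  | _, _, .counit => {(⟨[0], rfl⟩, ⟨[], rfl⟩)}
  | _, _, .mult => Set.range fun k : A × A => (⟨[k.1, k.2], rfl⟩, ⟨[k.1 + k.2], rfl⟩)
  | _, _, .unit => {(⟨[], rfl⟩, ⟨[0], rfl⟩)}

/-- The black GSOS specification for `S_FR`. -/
def blackGSOS (hκ : Bound A κ) : GSOS FR (Beh A κ) :=
  GSOS.coprod (smGSOS hκ) (genGSOS (blackLabels A) (by
    intro n m g
    cases g <;> exact hκ.range_one _))

/-- The white GSOS specification for `S_FR`. -/
def whiteGSOS [AddCommGroup A] (hκ : Bound A κ) : GSOS FR (Beh A κ) :=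
  GSOS.coprod (smGSOS hκ) (genGSOS (whiteLabels A) (by
    intro n m g
    cases g
    · exact hκ.range_two _
    · exact hκ.singleton _
    · exact hκ.range_two _
    · exact hκ.singleton _))

end Rules

end StringDiag

/-! A GSOS specification says what the law does to one operation, and the rest is forced. A term `op
o args` is the flattening of a single layer `o` whose variables are the terms `args`, so the
multiplication axiom determines the law on it from the law on the arguments. This gives uniqueness
by induction on terms and, read as a recursion, existence; the axioms then follow from naturality of
the specification and the monad laws (`GSOS.law`, `GSOS.law_extends`,
`DistributiveLaw.Extends.unique`).

Preservation of equations is a condition on the basic instances only, but it spreads to the whole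
congruence. Substitution instances are handled by the multiplication axiom together with naturality
of both sides of the equation. Closure under operations holds because the specification is natural
along the quotient map, so the behaviour of `op o args` modulo the equations depends only on that of
the arguments (`DistributiveLaw.Preserves.law_cong`). Hence the law descends to classes, uniquely,
since the quotient map is surjective.

It remains to check preservation. Two terms have the same behaviour modulo the equations if their
transitions match with equal labels and congruent targets. For the equations of symmetric monoidal
categories, a transition of one side splits into transitions of the variables, which recombine into
a transition of the other side; the two targets are the two sides of the same equation at the
targets of the variables (`DistributiveLaw.Extends.sm_law_eq`).

The Frobenius equations have no variables, and every constant only makes transitions to itself. A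
closed term built from them therefore also loops on itself, and its behaviour is just a relation
between input and output words; `;` composes relations and `⊗` juxtaposes them
(`DistributiveLaw.Loops`). Each Frobenius equation becomes an identity of relations. In the black
case both sides express equality of letters; in the white case, equality of the sum of the inputs
with the sum of the outputs, and inverses in `A` supply the hidden letter in the Frobenius laws. -/

namespace StringDiag

/-! ### The distributive law induced by a GSOS specification -/

section FreeLaw

variable {C : OpSig.{u}} {F : Sig.{u} ⥤ Sig.{u}}

theorem Sig.congr_app {X Y : Sig.{u}} {f g : X ⟶ Y} (h : f = g) {n m : ℕ} (x : X n m) :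
    f n m x = g n m x := by rw [h]

theorem Sig.map_map_app (F : Sig.{u} ⥤ Sig.{u}) {X Y Z : Sig.{u}} (f : X ⟶ Y) (g : Y ⟶ Z)
    {n m : ℕ} (x : F.obj X n m) : F.map g n m (F.map f n m x) = F.map (f ≫ g) n m x :=
  (Sig.congr_app (F.map_comp f g) x).symm

theorem Sig.naturality_app {F G : Sig.{u} ⥤ Sig.{u}} (α : F ⟶ G) {X Y : Sig.{u}} (f : X ⟶ Y)
    {n m : ℕ} (x : F.obj X n m) :
    α.app Y n m (F.map f n m x) = G.map f n m (α.app X n m x) :=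
  Sig.congr_app (α.naturality f) x

/-- A law that extends a GSOS specification is determined on operations by the specification. -/
theorem DistributiveLaw.Extends.law_op {l : DistributiveLaw C.free F} {r : GSOS C F}
    (h : l.Extends r) (X : Sig.{u}) {n m : ℕ} (o : C.Op n m)
    (args : ∀ a : C.Arg o, Tm C (F.obj X) (C.dom o a) (C.cod o a)) :
    l.law.app X n m (Tm.op o args) =
      F.map (C.free.μ.app X) n m
        (r.app (TmSig C X) n m ⟨o, fun a => l.law.app X _ _ (args a)⟩) := by
  -- The term is the flattening of one layer `o` with the arguments as variables. The law applied to
  -- that layer is evaluated by `Extends`.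
  have h1 := Sig.congr_app (l.mul_law X) (n := n) (m := m)
    (Tm.op (X := TmSig C (F.obj X)) o (fun a => Tm.var (args a)))
  have h2 := Sig.congr_app (h (TmSig C X)) (n := n) (m := m)
    ⟨o, fun a => l.law.app X _ _ (args a)⟩
  exact h1.trans (congrArg (F.map (C.free.μ.app X) n m) h2)

theorem DistributiveLaw.law_var (l : DistributiveLaw C.free F) (X : Sig.{u}) {n m : ℕ}
    (x : F.obj X n m) : l.law.app X n m (Tm.var x) = F.map (C.free.η.app X) n m x :=
  Sig.congr_app (l.unit_law X) x

theorem DistributiveLaw.ext_law {D : Type*} [Category D] {T : Monad D} {G : D ⥤ D}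
    {l l' : DistributiveLaw T G} (h : l.law = l'.law) : l = l' := by
  cases l; cases l'; cases h; rfl

/-- The unit axiom fixes a law on variables and the multiplication axiom fixes it on operations, so
induction on terms leaves no freedom. -/
theorem DistributiveLaw.Extends.unique {l l' : DistributiveLaw C.free F} {r : GSOS C F}
    (h : l.Extends r) (h' : l'.Extends r) : l' = l := by
  refine DistributiveLaw.ext_law (NatTrans.ext (funext fun X => ?_))
  funext n m (t : Tm C (F.obj X) n m)
  induction t with
  | var x => rw [l.law_var, l'.law_var]
  | op o args ih => rw [h.law_op, h'.law_op, funext ih]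

/-- The components of the law induced by a GSOS specification. -/
def GSOS.lawApp (r : GSOS C F) (X : Sig.{u}) :
    ∀ {n m : ℕ}, Tm C (F.obj X) n m → F.obj (TmSig C X) n m
  | n, m, Tm.var x => F.map (C.free.η.app X) n m x
  | n, m, Tm.op o args =>
      F.map (C.free.μ.app X) n m (r.app (TmSig C X) n m ⟨o, fun a => r.lawApp X (args a)⟩)

/-- Each clause of the recursion is a composite of natural maps: `η` on variables, then `r` and `μ`
on operations. -/
theorem GSOS.lawApp_map (r : GSOS C F) {X Y : Sig.{u}} (f : X ⟶ Y) {n m : ℕ}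
    (t : Tm C (F.obj X) n m) :
    r.lawApp Y (Tm.map (F.map f) t) = F.map (C.free.map f) n m (r.lawApp X t) := by
  induction t with
  | var x =>
    refine (Sig.map_map_app F f (C.free.η.app Y) x).trans
      (Eq.trans ?_ (Sig.map_map_app F (C.free.η.app X) (C.free.map f) x).symm)
    exact Sig.congr_app (congrArg F.map (C.free.η.naturality f)) x
  | op o args ih =>
    have h := Sig.naturality_app r (C.free.map f)
      ⟨o, fun a => r.lawApp X (args a)⟩
    refine Eq.trans (congrArg (F.map (C.free.μ.app Y) _ _) (Eq.trans ?_ h)) ?_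
    · exact congrArg (fun x => r.app (TmSig C Y) _ _ ⟨o, x⟩) (funext ih)
    · refine (Sig.map_map_app F (C.free.map (C.free.map f)) (C.free.μ.app Y) _).trans
        (Eq.trans ?_ (Sig.map_map_app F (C.free.μ.app X) (C.free.map f) _).symm)
      exact Sig.congr_app (congrArg F.map (C.free.μ.naturality f)) _

/-- This is the multiplication axiom. Variables reduce to a unit law of the monad; on operations,
naturality of `r` along `μ` moves the flattening of the arguments past the rule, and associativity
of `μ` finishes. -/
theorem GSOS.lawApp_join (r : GSOS C F) (X : Sig.{u}) {n m : ℕ}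
    (t : Tm C (TmSig C (F.obj X)) n m) :
    r.lawApp X (Tm.join t) = F.map (C.free.μ.app X) n m (r.lawApp (TmSig C X)
      (Tm.map (Y := F.obj (TmSig C X)) (fun _ _ s => r.lawApp X s) t)) := by
  induction t with
  | var s =>
    refine Eq.trans ?_ (Sig.map_map_app F (C.free.η.app (TmSig C X)) (C.free.μ.app X) _).symm
    exact (Sig.congr_app ((congrArg F.map (C.free.left_unit X)).trans (F.map_id _)) _).symm
  | op o args ih =>
    have h := Sig.naturality_app r (C.free.μ.app X) ⟨o, fun a => r.lawApp (TmSig C X)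
      (Tm.map (Y := F.obj (TmSig C X)) (fun _ _ s => r.lawApp X s) (args a))⟩
    refine Eq.trans (congrArg (F.map (C.free.μ.app X) _ _) (Eq.trans ?_ h)) ?_
    · exact congrArg (fun x => r.app (TmSig C X) _ _ ⟨o, x⟩) (funext ih)
    · refine (Sig.map_map_app F (C.free.map (C.free.μ.app X)) (C.free.μ.app X) _).trans
        (Eq.trans ?_ (Sig.map_map_app F (C.free.μ.app (TmSig C X)) (C.free.μ.app X) _).symm)
      exact Sig.congr_app (congrArg F.map (C.free.assoc X)) _

/-- The distributive law induced by a GSOS specification. -/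
def GSOS.law (r : GSOS C F) : DistributiveLaw C.free F where
  law :=
    { app := fun X _ _ t => r.lawApp X t
      naturality := fun X Y f => by
        funext n m t
        exact r.lawApp_map f t }
  unit_law _ := rfl
  mul_law X := by
    funext n m t
    exact r.lawApp_join X t

/-- On an operation applied to variables the recursion applies `r` to arguments that have passed
through `η`. Naturality of `r` moves `η` to the targets, where the following `μ` cancels it. -/
theorem GSOS.law_extends (r : GSOS C F) : r.law.Extends r := by
  intro X
  funext n m ⟨o, args⟩
  have h := Sig.naturality_app r (C.free.η.app X) ⟨o, args⟩
  refine (congrArg (F.map (C.free.μ.app X) n m) h).trans ?_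
  refine (Sig.map_map_app F (C.free.map (C.free.η.app X)) (C.free.μ.app X) _).trans ?_
  exact Sig.congr_app ((congrArg F.map (C.free.right_unit X)).trans (F.map_id _)) _

end FreeLaw

/-! ### Descent of a law to the quotient monad -/

section QuotientLaw

variable {C : OpSig.{u}} {F : Sig.{u} ⥤ Sig.{u}} {E : Equations C}

theorem Equations.proj_mu (E : Equations C) (X : Sig.{u}) :
    C.free.μ.app X ≫ E.proj.app X =
      (C.free.map (E.proj.app X) ≫ E.proj.app (E.Quo X)) ≫ E.quotient.μ.app X :=
  E.proj.app_μ X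

/-- The law identifies congruent terms up to congruence of the targets. -/
theorem DistributiveLaw.Preserves.law_cong {l : DistributiveLaw C.free F} {r : GSOS C F}
    (hr : l.Extends r) (hl : l.Preserves E) (X : Sig.{u}) {n m : ℕ} {s t : Tm C (F.obj X) n m}
    (h : E.Cong (F.obj X) s t) :
    F.map (E.proj.app X) n m (l.law.app X n m s) =
      F.map (E.proj.app X) n m (l.law.app X n m t) := by
  -- Flattening and then taking classes can be done by first taking classes of the inner terms. The
  -- next fact takes classes of the outer term first. The congruence rule for operations needs the
  -- former order, the equation instances the latter.
  have hmu {n m : ℕ} (z : F.obj (TmSig C (TmSig C X)) n m) :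
      F.map (E.proj.app X) n m (F.map (C.free.μ.app X) n m z) =
        F.map (E.proj.app (E.Quo X) ≫ E.quotient.μ.app X) n m
          (F.map (C.free.map (E.proj.app X)) n m z) :=
    (Sig.map_map_app F (C.free.μ.app X) (E.proj.app X) z).trans
      ((Sig.congr_app (congrArg F.map (E.proj_mu X)) z).trans
        (Sig.map_map_app F (C.free.map (E.proj.app X))
          (E.proj.app (E.Quo X) ≫ E.quotient.μ.app X) z).symm)
  have hmu' {n m : ℕ} (z : F.obj (TmSig C (TmSig C X)) n m) :
      F.map (E.proj.app X) n m (F.map (C.free.μ.app X) n m z) =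
        F.map (E.quotient.map (E.proj.app X) ≫ E.quotient.μ.app X) n m
          (F.map (E.proj.app (TmSig C X)) n m z) :=
    (hmu z).trans ((Sig.map_map_app F _ _ z).trans
      (Sig.map_map_app F (E.proj.app (TmSig C X))
        (E.quotient.map (E.proj.app X) ≫ E.quotient.μ.app X) z).symm)
  induction h with
  | @eqn n m x =>
    -- By the multiplication axiom and naturality of `k`, a substitution instance is evaluated as a
    -- basic instance whose variables are the behaviours of the substituted terms. Preservation then
    -- applies at the object `TmSig C X`.
    have key (k : E.vars ⟶ C.free.toFunctor) :
        F.map (E.proj.app X) n m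
          (l.law.app X n m (Tm.join (k.app (TmSig C (F.obj X)) n m x))) =
        F.map (E.quotient.map (E.proj.app X) ≫ E.quotient.μ.app X) n m
          (F.map (E.proj.app (TmSig C X)) n m (l.law.app (TmSig C X) n m
            (k.app (F.obj (TmSig C X)) n m (E.vars.map (l.law.app X) n m x)))) := by
      have h1 := Sig.congr_app (l.mul_law X) (k.app (TmSig C (F.obj X)) n m x)
      refine (congrArg (F.map (E.proj.app X) n m) h1).trans ((hmu' _).trans ?_)
      have h2 := Sig.naturality_app k (l.law.app X) x
      exact congrArg (fun z => F.map (E.quotient.map (E.proj.app X) ≫ E.quotient.μ.app X) n m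
          (F.map (E.proj.app (TmSig C X)) n m (l.law.app (TmSig C X) n m z))) h2.symm
    refine (key E.lhs).trans (Eq.trans ?_ (key E.rhs).symm)
    exact congrArg (F.map (E.quotient.map (E.proj.app X) ≫ E.quotient.μ.app X) n m)
      (Sig.congr_app (hl (TmSig C X)) _)
  | @op n m o s t _ ih =>
    -- Naturality of `r` along the quotient map shows that only the behaviours of the arguments
    -- modulo the equations matter; these agree by the induction hypothesis.
    have key (s : ∀ a : C.Arg o, Tm C (F.obj X) (C.dom o a) (C.cod o a)) :
        F.map (E.proj.app X) n m (l.law.app X n m (Tm.op o s)) =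
        F.map (E.proj.app (E.Quo X) ≫ E.quotient.μ.app X) n m
          (r.app (E.Quo X) n m
            ⟨o, fun a => F.map (E.proj.app X) _ _ (l.law.app X _ _ (s a))⟩) := by
      rw [hr.law_op]
      refine (hmu _).trans ?_
      exact congrArg (F.map (E.proj.app (E.Quo X) ≫ E.quotient.μ.app X) n m)
        (Sig.naturality_app r (E.proj.app X) ⟨o, fun a => l.law.app X _ _ (s a)⟩).symm
    rw [key, key, funext ih]
  | refl t => rfl
  | symm _ ih => exact ih.symm
  | trans _ _ ih ih' => exact ih.trans ih'

/-- The law on classes induced by a law that preserves the equations. -/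
noncomputable def DistributiveLaw.Preserves.quotientApp {l : DistributiveLaw C.free F} {r : GSOS C F}
    (hr : l.Extends r) (hl : l.Preserves E) (X : Sig.{u}) :
    E.Quo (F.obj X) ⟶ F.obj (E.Quo X) := fun n m =>
  Quotient.lift (s := E.setoid (F.obj X) n m)
    (fun t => F.map (E.proj.app X) n m (l.law.app X n m t))
    (fun _ _ h => hl.law_cong hr X h)

/-- The quotient of a law that preserves the equations. -/
noncomputable def DistributiveLaw.Preserves.quotient {l : DistributiveLaw C.free F} {r : GSOS C F}
    (hr : l.Extends r) (hl : l.Preserves E) : DistributiveLaw E.quotient F where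
  law :=
    { app := fun X => hl.quotientApp hr X
      naturality := fun X Y f => by
        funext n m x
        obtain ⟨t, rfl⟩ := E.cls_surj x
        have h := Sig.naturality_app l.law f t
        refine (congrArg (F.map (E.proj.app Y) n m) h).trans ?_
        exact (Sig.map_map_app F (C.free.map f) (E.proj.app Y) _).trans
          (Sig.map_map_app F (E.proj.app X) (E.quotient.map f) _).symm }
  unit_law X := by
    funext n m x
    refine (congrArg (F.map (E.proj.app X) n m) (l.law_var X x)).trans ?_
    exact Sig.map_map_app F (C.free.η.app X) (E.proj.app X) x
  mul_law X := by
    funext n m x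
    obtain ⟨t, rfl⟩ := E.cls_surj x
    -- Choosing a term of terms `s` that represents the class reduces the axiom to the
    -- multiplication axiom of `l` at `s`; naturality of `l` along the quotient map and
    -- compatibility of that map with `μ` do the rest.
    obtain ⟨s, rfl⟩ := E.lift_out t
    have h1 : l.law.app X n m (Tm.join s) = F.map (C.free.μ.app X) n m
        (l.law.app (TmSig C X) n m (Tm.map (l.law.app X) s)) := Sig.congr_app (l.mul_law X) s
    have h2 : Tm.map (hl.quotientApp hr X) (Tm.map (E.clsHom (F.obj X)) s) =
        Tm.map (F.map (E.proj.app X)) (Tm.map (l.law.app X) s) :=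
      (Tm.map_map _ _ s).trans (Tm.map_map (l.law.app X) (F.map (E.proj.app X)) s).symm
    have h3 := Sig.naturality_app l.law (E.proj.app X) (Tm.map (l.law.app X) s)
    have h4 : l.law.app (E.Quo X) n m
          (Tm.map (hl.quotientApp hr X) (Tm.map (E.clsHom (F.obj X)) s)) =
        F.map (C.free.map (E.proj.app X)) n m
          (l.law.app (TmSig C X) n m (Tm.map (l.law.app X) s)) :=
      (congrArg (l.law.app (E.Quo X) n m) h2).trans h3
    refine (congrArg (hl.quotientApp hr X n m) (E.quoJoin_cls s)).trans ?_
    refine (congrArg (F.map (E.proj.app X) n m) h1).trans ?_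
    refine Eq.trans ?_ (congrArg (fun z => F.map (E.quotient.μ.app X) n m
      (F.map (E.proj.app (E.Quo X)) n m z)) h4).symm
    refine (Sig.map_map_app F (C.free.μ.app X) (E.proj.app X) _).trans ?_
    refine (Sig.congr_app (congrArg F.map (E.proj_mu X)) _).trans ?_
    refine (Sig.map_map_app F _ (E.quotient.μ.app X) _).symm.trans ?_
    exact congrArg (F.map (E.quotient.μ.app X) n m) (Sig.map_map_app F _ _ _).symm

/-- Uniqueness holds because every class has a representative, on which the quotient condition
prescribes the value. -/
theorem DistributiveLaw.Preserves.existsUnique_quotient {l : DistributiveLaw C.free F}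
    {r : GSOS C F} (hr : l.Extends r) (hl : l.Preserves E) :
    ∃! k : DistributiveLaw E.quotient F, k.IsQuotientOf (E := E) l := by
  refine ⟨hl.quotient hr, fun X => rfl, fun k hk => ?_⟩
  refine DistributiveLaw.ext_law (NatTrans.ext (funext fun X => ?_))
  funext n m x
  obtain ⟨t, rfl⟩ := E.cls_surj x
  exact Sig.congr_app (hk X) t

end QuotientLaw

/-! ### Terms over `FR`: inclusion of prop terms, substitution, and the two families of equations -/

namespace FR

variable {X Y : Sig.{u}}

/-- The identity on `0`. -/
def nil : Tm FR X 0 0 := Tm.op (C := FR) (Sum.inl SMOp.unit) (fun a => Empty.elim a)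

/-- The identity on `n`. -/
def idN (n : ℕ) : Tm FR X n n := Tm.inl Frob (SM.idN n)

/-- The symmetry `1 + n → n + 1`. -/
def sym1N (n : ℕ) : Tm FR X (1 + n) (n + 1) := Tm.inl Frob (SM.sym1N n)

/-- The symmetry `n + 1 → 1 + n`. -/
def symN1 (n : ℕ) : Tm FR X (n + 1) (1 + n) := Tm.inl Frob (SM.symN1 n)

theorem inl_seq {n z m : ℕ} (s : Tm SM X n z) (t : Tm SM X z m) :
    Tm.inl Frob (SM.seq s t) = seq (Tm.inl Frob s) (Tm.inl Frob t) := by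
  refine congrArg (Tm.op (C := FR) (Sum.inl (SMOp.seq n z m))) ?_
  funext a
  cases a <;> rfl

theorem inl_par {n₁ m₁ n₂ m₂ n m : ℕ} (hn : n₁ + n₂ = n) (hm : m₁ + m₂ = m)
    (s : Tm SM X n₁ m₁) (t : Tm SM X n₂ m₂) :
    Tm.inl Frob (SM.par hn hm s t) = par hn hm (Tm.inl Frob s) (Tm.inl Frob t) := by
  refine congrArg (Tm.op (C := FR) (Sum.inl (SMOp.par n₁ m₁ n₂ m₂ hn hm))) ?_
  funext a
  cases a <;> rfl

theorem inl_var {n m : ℕ} (x : X n m) : Tm.inl Frob (Tm.var (C := SM) x) = Tm.var (C := FR) x :=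
  rfl

theorem inl_id1 : Tm.inl Frob (SM.id1 : Tm SM X 1 1) = id1 := by
  refine congrArg (Tm.op (C := FR) (Sum.inl SMOp.idn)) ?_
  funext a
  exact Empty.elim a

theorem inl_unit : Tm.inl Frob (SM.unit : Tm SM X 0 0) = nil := by
  refine congrArg (Tm.op (C := FR) (Sum.inl SMOp.unit)) ?_
  funext a
  exact Empty.elim a

theorem inl_sym : Tm.inl Frob (SM.sym : Tm SM X 2 2) = sym := by
  refine congrArg (Tm.op (C := FR) (Sum.inl SMOp.sym)) ?_
  funext a
  exact Empty.elim a

theorem inl_idN (n : ℕ) : Tm.inl Frob (SM.idN n : Tm SM X n n) = idN n := rfl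

theorem inl_sym1N (n : ℕ) : Tm.inl Frob (SM.sym1N n : Tm SM X (1 + n) (n + 1)) = sym1N n := rfl

theorem inl_symN1 (n : ℕ) : Tm.inl Frob (SM.symN1 n : Tm SM X (n + 1) (1 + n)) = symN1 n := rfl

theorem idN_zero : (idN 0 : Tm FR X 0 0) = nil := inl_unit

theorem idN_succ (n : ℕ) : (idN (n + 1) : Tm FR X (n + 1) (n + 1)) = par rfl rfl (idN n) id1 :=
  (inl_par _ _ _ _).trans (congrArg _ inl_id1)

theorem sym1N_zero : (sym1N 0 : Tm FR X 1 1) = id1 := inl_id1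

theorem sym1N_succ (n : ℕ) : (sym1N (n + 1) : Tm FR X (1 + (n + 1)) (n + 1 + 1)) =
    seq (z := n + 2) (par (m₁ := n + 1) (Nat.add_assoc 1 n 1) rfl (sym1N n) id1)
      (par (n₂ := 2) (m₂ := 2) rfl rfl (idN n) sym) := by
  simp only [sym1N, SM.sym1N, inl_seq, inl_par, inl_id1, inl_sym, idN]

theorem symN1_zero : (symN1 0 : Tm FR X 1 1) = id1 := inl_id1

theorem symN1_succ (n : ℕ) : (symN1 (n + 1) : Tm FR X (n + 1 + 1) (1 + (n + 1))) =
    seq (z := n + 2) (par (n₂ := 2) (m₂ := 2) rfl rfl (idN n) sym)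
      (par (n₁ := n + 1) rfl (Nat.add_assoc 1 n 1) (symN1 n) id1) := by
  simp only [symN1, SM.symN1, inl_seq, inl_par, inl_id1, inl_sym, idN]

section Bind

variable (f : ∀ n m : ℕ, X n m → Tm FR Y n m)

theorem bind_seq {n z m : ℕ} (s : Tm FR X n z) (t : Tm FR X z m) :
    Tm.bind f (seq s t) = seq (Tm.bind f s) (Tm.bind f t) := by
  refine congrArg (Tm.op (C := FR) (Sum.inl (SMOp.seq n z m))) ?_
  funext a
  cases a <;> rfl

theorem bind_par {n₁ m₁ n₂ m₂ n m : ℕ} (hn : n₁ + n₂ = n) (hm : m₁ + m₂ = m)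
    (s : Tm FR X n₁ m₁) (t : Tm FR X n₂ m₂) :
    Tm.bind f (par hn hm s t) = par hn hm (Tm.bind f s) (Tm.bind f t) := by
  refine congrArg (Tm.op (C := FR) (Sum.inl (SMOp.par n₁ m₁ n₂ m₂ hn hm))) ?_
  funext a
  cases a <;> rfl

theorem bind_id1 : Tm.bind f (id1 : Tm FR X 1 1) = id1 := by
  refine congrArg (Tm.op (C := FR) (Sum.inl SMOp.idn)) ?_
  funext a
  exact Empty.elim a

theorem bind_nil : Tm.bind f (nil : Tm FR X 0 0) = nil := by
  refine congrArg (Tm.op (C := FR) (Sum.inl SMOp.unit)) ?_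
  funext a
  exact Empty.elim a

theorem bind_sym : Tm.bind f (sym : Tm FR X 2 2) = sym := by
  refine congrArg (Tm.op (C := FR) (Sum.inl SMOp.sym)) ?_
  funext a
  exact Empty.elim a

theorem bind_gen {n m : ℕ} (g : FrobOp n m) : Tm.bind f (gen g : Tm FR X n m) = gen g := by
  refine congrArg (Tm.op (C := FR) (Sum.inr g)) ?_
  funext a
  exact Empty.elim a

theorem bind_idN (n : ℕ) : Tm.bind f (idN n : Tm FR X n n) = idN n := by
  induction n with
  | zero => simp only [idN_zero, bind_nil]
  | succ n ih => simp only [idN_succ, bind_par, ih, bind_id1]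

theorem bind_sym1N (n : ℕ) : Tm.bind f (sym1N n : Tm FR X (1 + n) (n + 1)) = sym1N n := by
  induction n with
  | zero => exact (congrArg (Tm.bind f) sym1N_zero).trans ((bind_id1 f).trans sym1N_zero.symm)
  | succ n ih => simp only [sym1N_succ, bind_seq, bind_par, ih, bind_id1, bind_idN, bind_sym]

theorem bind_symN1 (n : ℕ) : Tm.bind f (symN1 n : Tm FR X (n + 1) (1 + n)) = symN1 n := by
  induction n with
  | zero => exact (congrArg (Tm.bind f) symN1_zero).trans ((bind_id1 f).trans symN1_zero.symm)
  | succ n ih => simp only [symN1_succ, bind_seq, bind_par, ih, bind_id1, bind_idN, bind_sym]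

/-- Substitution leaves the sides of the Frobenius equations unchanged. -/
theorem bind_lhs {n m : ℕ} (e : EqName.{u} n m) : Tm.bind f (lhs e : Tm FR X n m) = lhs e := by
  cases e <;> simp only [lhs, comult, counit, mult, unit, bind_seq, bind_par, bind_id1, bind_sym,
    bind_gen]

theorem bind_rhs {n m : ℕ} (e : EqName.{u} n m) : Tm.bind f (rhs e : Tm FR X n m) = rhs e := by
  cases e <;> simp only [rhs, comult, mult, bind_seq, bind_par, bind_id1, bind_gen]

end Bind

section Join

theorem join_var {n m : ℕ} (t : TmSig FR X n m) : Tm.join (C := FR) (X := X) (Tm.var t) = t := rfl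

theorem join_seq {n z m : ℕ} (s : Tm FR (TmSig FR X) n z) (t : Tm FR (TmSig FR X) z m) :
    Tm.join (seq s t) = seq (Tm.join s) (Tm.join t) :=
  bind_seq (X := TmSig FR X) _ s t

theorem join_par {n₁ m₁ n₂ m₂ n m : ℕ} (hn : n₁ + n₂ = n) (hm : m₁ + m₂ = m)
    (s : Tm FR (TmSig FR X) n₁ m₁) (t : Tm FR (TmSig FR X) n₂ m₂) :
    Tm.join (par hn hm s t) = par hn hm (Tm.join s) (Tm.join t) :=
  bind_par (X := TmSig FR X) _ hn hm s t

theorem join_id1 : Tm.join (id1 : Tm FR (TmSig FR X) 1 1) = id1 := bind_id1 (X := TmSig FR X) _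

theorem join_nil : Tm.join (nil : Tm FR (TmSig FR X) 0 0) = nil := bind_nil (X := TmSig FR X) _

theorem join_sym : Tm.join (sym : Tm FR (TmSig FR X) 2 2) = sym := bind_sym (X := TmSig FR X) _

theorem join_idN (n : ℕ) : Tm.join (idN n : Tm FR (TmSig FR X) n n) = idN n :=
  bind_idN (X := TmSig FR X) _ n

theorem join_sym1N (n : ℕ) :
    Tm.join (sym1N n : Tm FR (TmSig FR X) (1 + n) (n + 1)) = sym1N n :=
  bind_sym1N (X := TmSig FR X) _ n

theorem join_symN1 (n : ℕ) :
    Tm.join (symN1 n : Tm FR (TmSig FR X) (n + 1) (1 + n)) = symN1 n :=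
  bind_symN1 (X := TmSig FR X) _ n

end Join

/-- The left-hand sides of the equations of symmetric monoidal categories, over `FR`. -/
theorem inl_lhs {n m : ℕ} (x : SM.EqVars X n m) :
    (Tm.inl Frob (SM.lhs x) : Tm FR X n m) = match x with
    | .parAssoc f g h => par rfl rfl (par rfl rfl (.var f) (.var g)) (.var h)
    | .parUnitLeft f => par (Nat.zero_add _) (Nat.zero_add _) nil (.var f)
    | .parUnitRight f => par rfl rfl (.var f) nil
    | .symSym => seq sym sym
    | .interchange f g h i => par rfl rfl (seq (.var f) (.var g)) (seq (.var h) (.var i))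
    | .seqAssoc f g h => seq (seq (.var f) (.var g)) (.var h)
    | .seqIdRight f => seq (.var f) (idN _)
    | .seqIdLeft f => seq (idN _) (.var f)
    | .symNatLeft f => seq (sym1N _) (par rfl rfl (.var f) id1)
    | .symNatRight f => seq (symN1 _) (par rfl rfl id1 (.var f)) := by
  cases x <;> simp only [SM.lhs, inl_seq, inl_par, inl_id1, inl_unit, inl_sym, inl_var, inl_idN,
    inl_sym1N, inl_symN1] <;> rfl

/-- The right-hand sides of the equations of symmetric monoidal categories, over `FR`. -/
theorem inl_rhs {n m : ℕ} (x : SM.EqVars X n m) :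
    (Tm.inl Frob (SM.rhs x) : Tm FR X n m) = match x with
    | .parAssoc f g h =>
      par (Nat.add_assoc _ _ _).symm (Nat.add_assoc _ _ _).symm (.var f)
        (par rfl rfl (.var g) (.var h))
    | .parUnitLeft f => .var f
    | .parUnitRight f => .var f
    | .symSym => idN 2
    | .interchange f g h i =>
      seq (par rfl rfl (.var f) (.var h)) (par rfl rfl (.var g) (.var i))
    | .seqAssoc f g h => seq (.var f) (seq (.var g) (.var h))
    | .seqIdRight f => .var f
    | .seqIdLeft f => .var f
    | .symNatLeft f => seq (par rfl rfl id1 (.var f)) (sym1N _)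
    | .symNatRight f => seq (par rfl rfl (.var f) id1) (symN1 _) := by
  cases x <;> simp only [SM.rhs, inl_seq, inl_par, inl_id1, inl_var, inl_idN,
    inl_sym1N, inl_symN1] <;> rfl

/-- The left-hand sides of the equations of symmetric monoidal categories, at terms. -/
theorem join_inl_lhs {n m : ℕ} (x : SM.EqVars (TmSig FR X) n m) :
    Tm.join (C := FR) (Tm.inl Frob (SM.lhs x)) = match x with
    | .parAssoc f g h => par rfl rfl (par rfl rfl f g) h
    | .parUnitLeft f => par (Nat.zero_add _) (Nat.zero_add _) nil f
    | .parUnitRight f => par rfl rfl f nil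
    | .symSym => seq sym sym
    | .interchange f g h i => par rfl rfl (seq f g) (seq h i)
    | .seqAssoc f g h => seq (seq f g) h
    | .seqIdRight f => seq f (idN _)
    | .seqIdLeft f => seq (idN _) f
    | .symNatLeft f => seq (sym1N _) (par rfl rfl f id1)
    | .symNatRight f => seq (symN1 _) (par rfl rfl id1 f) := by
  rw [inl_lhs (X := TmSig FR X)]
  cases x <;> simp only [join_seq, join_par, join_id1, join_nil, join_sym, join_idN,
    join_sym1N, join_symN1, join_var]

/-- The right-hand sides of the equations of symmetric monoidal categories, at terms. -/
theorem join_inl_rhs {n m : ℕ} (x : SM.EqVars (TmSig FR X) n m) :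
    Tm.join (C := FR) (Tm.inl Frob (SM.rhs x)) = match x with
    | .parAssoc f g h =>
      par (Nat.add_assoc _ _ _).symm (Nat.add_assoc _ _ _).symm f (par rfl rfl g h)
    | .parUnitLeft f => f
    | .parUnitRight f => f
    | .symSym => idN 2
    | .interchange f g h i => seq (par rfl rfl f h) (par rfl rfl g i)
    | .seqAssoc f g h => seq f (seq g h)
    | .seqIdRight f => f
    | .seqIdLeft f => f
    | .symNatLeft f => seq (par rfl rfl id1 f) (sym1N _)
    | .symNatRight f => seq (par rfl rfl f id1) (symN1 _) := by
  rw [inl_rhs (X := TmSig FR X)]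
  cases x <;> simp only [join_seq, join_par, join_id1, join_idN,
    join_sym1N, join_symN1, join_var] <;> rfl

/-- Congruences on terms that contain the equations of symmetric monoidal categories. -/
def ContainsSM (E : Equations FR.{u}) : Prop :=
  ∀ (X : Sig.{u}) {n m : ℕ} (x : SM.EqVars (TmSig FR X) n m),
    E.Cong X (Tm.join (C := FR) (Tm.inl Frob (SM.lhs x)))
      (Tm.join (C := FR) (Tm.inl Frob (SM.rhs x)))

/-- Congruences on terms that contain the equations of special Frobenius bimonoids. -/
def ContainsFrob (E : Equations FR.{u}) : Prop :=
  ∀ (X : Sig.{u}) {n m : ℕ} (e : EqName.{u} n m), E.Cong X (lhs e) (rhs e)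

/-- The congruence is generated by flattened instances, and the sides of the Frobenius equations
have no variables, so flattening returns the same closed terms. -/
theorem containsFrob_frobEquations : ContainsFrob frobEquations.{u} := by
  intro X n m e
  have h := Equations.Cong.eqn (E := frobEquations) (X := X) (n := n) (m := m) e
  have hl : Tm.join (lhs e : Tm FR (TmSig FR X) n m) = lhs e := bind_lhs (X := TmSig FR X) _ e
  have hr : Tm.join (rhs e : Tm FR (TmSig FR X) n m) = rhs e := bind_rhs (X := TmSig FR X) _ e
  rw [← hl, ← hr]
  exact h

theorem containsFrob_cwEquations : ContainsFrob cwEquations.{u} := by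
  intro X n m e
  have h := Equations.Cong.eqn (E := cwEquations) (X := X) (n := n) (m := m) (Sum.inr e)
  have hl : Tm.join (lhs e : Tm FR (TmSig FR X) n m) = lhs e := bind_lhs (X := TmSig FR X) _ e
  have hr : Tm.join (rhs e : Tm FR (TmSig FR X) n m) = rhs e := bind_rhs (X := TmSig FR X) _ e
  rw [← hl, ← hr]
  exact h

theorem containsSM_cwEquations : ContainsSM cwEquations.{u} := by
  intro X n m x
  exact Equations.Cong.eqn (E := cwEquations) (X := X) (n := n) (m := m) (Sum.inl x)

end FR

/-! ### The transition rules, read off from a law that extends the specification -/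

section Transitions

variable {A : Type u} {κ : Cardinal.{u}} {hκ : Bound A κ}
  {R : ∀ {n m : ℕ}, FrobOp.{u} n m → Set (Word A n × Word A m)}
  {hR : ∀ {n m : ℕ} (g : FrobOp n m), Cardinal.mk (R g) ≤ κ}
  {l : DistributiveLaw FR.free (Beh A κ)}

/-- The transitions that a law gives to a term over sets of transitions. -/
def DistributiveLaw.transitions (l : DistributiveLaw FR.free (Beh A κ)) {X : Sig.{u}} {n m : ℕ}
    (t : Tm FR ((Beh A κ).obj X) n m) : Set (Transition A (TmSig FR X) n m) :=
  (l.law.app X n m t).1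

variable {X : Sig.{u}}

variable (hl : l.Extends (GSOS.coprod (smGSOS hκ) (genGSOS R hR)))
include hl

/-- The set given by the rule passes through two direct images, one along the inclusion of prop
terms into `FR`-terms and one along flattening. Together they turn the rule's target, a composite of
two variables that stand for terms, into the composite of these terms. -/
theorem DistributiveLaw.Extends.transitions_seq {n z m : ℕ} (s : Tm FR ((Beh A κ).obj X) n z)
    (t : Tm FR ((Beh A κ).obj X) z m) :
    l.transitions (FR.seq s t) = {τ | ∃ ρ ∈ l.transitions s, ∃ σ ∈ l.transitions t, ρ.right = σ.left ∧
      τ = ⟨ρ.left, FR.seq ρ.target σ.target, σ.right⟩} := by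
  refine (congrArg Subtype.val (hl.law_op X (n := n) (m := m)
    (Sum.inl (SMOp.seq n z m)) _)).trans ?_
  have key (ρ : Transition A (TmSig FR X) n z) (σ : Transition A (TmSig FR X) z m) :
      Tm.join (Tm.inl Frob (SM.seq (Tm.var ρ.target) (Tm.var σ.target))) =
        FR.seq ρ.target σ.target := by
    rw [FR.inl_seq]; exact FR.bind_seq _ _ _
  ext τ
  constructor
  · rintro ⟨_, ⟨_, ⟨ρ, hρ, σ, hσ, h, rfl⟩, rfl⟩, rfl⟩
    exact ⟨ρ, hρ, σ, hσ, h, Transition.ext rfl (key ρ σ) rfl⟩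
  · rintro ⟨ρ, hρ, σ, hσ, h, rfl⟩
    exact ⟨_, ⟨_, ⟨ρ, hρ, σ, hσ, h, rfl⟩, rfl⟩, Transition.ext rfl (key ρ σ) rfl⟩

theorem DistributiveLaw.Extends.transitions_par {n₁ m₁ n₂ m₂ n m : ℕ} (hn : n₁ + n₂ = n)
    (hm : m₁ + m₂ = m) (s : Tm FR ((Beh A κ).obj X) n₁ m₁) (t : Tm FR ((Beh A κ).obj X) n₂ m₂) :
    l.transitions (FR.par hn hm s t) = {τ | ∃ ρ ∈ l.transitions s, ∃ σ ∈ l.transitions t,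
      τ = ⟨Word.append hn ρ.left σ.left, FR.par hn hm ρ.target σ.target,
        Word.append hm ρ.right σ.right⟩} := by
  refine (congrArg Subtype.val (hl.law_op X (n := n) (m := m)
    (Sum.inl (SMOp.par n₁ m₁ n₂ m₂ hn hm)) _)).trans ?_
  have key (ρ : Transition A (TmSig FR X) n₁ m₁) (σ : Transition A (TmSig FR X) n₂ m₂) :
      Tm.join (Tm.inl Frob (SM.par hn hm (Tm.var ρ.target) (Tm.var σ.target))) =
        FR.par hn hm ρ.target σ.target := by
    rw [FR.inl_par]; exact FR.bind_par _ _ _ _ _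
  ext τ
  constructor
  · rintro ⟨_, ⟨_, ⟨ρ, hρ, σ, hσ, -, rfl⟩, rfl⟩, rfl⟩
    exact ⟨ρ, hρ, σ, hσ, Transition.ext rfl (key ρ σ) rfl⟩
  · rintro ⟨ρ, hρ, σ, hσ, rfl⟩
    exact ⟨_, ⟨_, ⟨ρ, hρ, σ, hσ, trivial, rfl⟩, rfl⟩, Transition.ext rfl (key ρ σ) rfl⟩

/-- For a constant, the inclusion and the flattening both fix the target, so the two images only
have to be merged into one range. The other constants are treated in the same way. -/
theorem DistributiveLaw.Extends.transitions_id1 :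
    l.transitions (FR.id1 : Tm FR ((Beh A κ).obj X) 1 1) =
      Set.range fun k : A => ⟨⟨[k], rfl⟩, FR.id1, ⟨[k], rfl⟩⟩ := by
  refine (congrArg Subtype.val (hl.law_op X (Sum.inl SMOp.idn) _)).trans ?_
  refine (congrArg _ (Set.range_comp _ _).symm).trans ((Set.range_comp _ _).symm.trans ?_)
  exact congrArg Set.range (funext fun k => Transition.ext rfl
    ((congrArg Tm.join FR.inl_id1).trans (FR.bind_id1 _)) rfl)

theorem DistributiveLaw.Extends.transitions_nil :
    l.transitions (FR.nil : Tm FR ((Beh A κ).obj X) 0 0) = {⟨⟨[], rfl⟩, FR.nil, ⟨[], rfl⟩⟩} := by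
  refine (congrArg Subtype.val (hl.law_op X (Sum.inl SMOp.unit) _)).trans ?_
  refine (congrArg _ Set.image_singleton).trans (Set.image_singleton.trans ?_)
  exact congrArg singleton (Transition.ext rfl
    ((congrArg Tm.join FR.inl_unit).trans (FR.bind_nil _)) rfl)

theorem DistributiveLaw.Extends.transitions_sym :
    l.transitions (FR.sym : Tm FR ((Beh A κ).obj X) 2 2) =
      Set.range fun k : A × A => ⟨⟨[k.1, k.2], rfl⟩, FR.sym, ⟨[k.2, k.1], rfl⟩⟩ := by
  refine (congrArg Subtype.val (hl.law_op X (Sum.inl SMOp.sym) _)).trans ?_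
  refine (congrArg _ (Set.range_comp _ _).symm).trans ((Set.range_comp _ _).symm.trans ?_)
  exact congrArg Set.range (funext fun k => Transition.ext rfl
    ((congrArg Tm.join FR.inl_sym).trans (FR.bind_sym _)) rfl)

theorem DistributiveLaw.Extends.transitions_gen {n m : ℕ} (g : FrobOp n m) :
    l.transitions (FR.gen g : Tm FR ((Beh A κ).obj X) n m) =
      (fun p => ⟨p.1, FR.gen g, p.2⟩) '' R g := by
  refine (congrArg Subtype.val (hl.law_op X (Sum.inr g) _)).trans ?_
  refine (congrArg _ (Set.image_image _ _ _)).trans ((Set.image_image _ _ _).trans ?_)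
  refine congrArg (· '' R g) (funext fun p => Transition.ext rfl ?_ rfl)
  refine Eq.trans (congrArg (Tm.join (C := FR)) ?_) (FR.bind_gen _ g)
  refine congrArg (Tm.op (C := FR) (Sum.inr g)) ?_
  funext a
  exact Empty.elim a

end Transitions

/-- This splitting fits the recursion of the symmetries `1 + n → n + 1` and back: one letter crosses
the middle word `u`, then is exchanged with the last letter. -/
theorem _root_.List.exists_cons_append_singleton {α : Type*} {v : List α} {n : ℕ}
    (h : v.length = n + 2) : ∃ (a : α) (u : List α) (b : α), v = a :: (u ++ [b]) ∧ u.length = n := by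
  obtain ⟨a, v, rfl⟩ := List.exists_cons_of_length_pos (l := v) (by omega)
  rcases v.eq_nil_or_concat with rfl | ⟨u, b, rfl⟩
  · simp at h
  · exact ⟨a, u, b, by rw [List.concat_eq_append], by simpa using h⟩

/-! ### Single transitions, and closed terms as relations on words -/

section Step

variable {A : Type u} {κ : Cardinal.{u}} {hκ : Bound A κ}
  {R : ∀ {n m : ℕ}, FrobOp.{u} n m → Set (Word A n × Word A m)}
  {hR : ∀ {n m : ℕ} (g : FrobOp n m), Cardinal.mk (R g) ≤ κ}
  {l : DistributiveLaw FR.free (Beh A κ)} {X : Sig.{u}}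

/-- The law gives to `t` a transition to `t'` with labels `v` and `w`. -/
def DistributiveLaw.Step (l : DistributiveLaw FR.free (Beh A κ)) {X : Sig.{u}} {n m : ℕ}
    (t : Tm FR ((Beh A κ).obj X) n m) (v : List A) (t' : Tm FR X n m) (w : List A) : Prop :=
  ∃ τ ∈ l.transitions t, τ.left.1 = v ∧ τ.target = t' ∧ τ.right.1 = w

theorem DistributiveLaw.Step.length_left {n m : ℕ} {t : Tm FR ((Beh A κ).obj X) n m} {v w : List A}
    {t' : Tm FR X n m} (h : l.Step t v t' w) : v.length = n := by
  obtain ⟨τ, -, rfl, -, -⟩ := h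
  exact τ.left.2

theorem DistributiveLaw.Step.length_right {n m : ℕ} {t : Tm FR ((Beh A κ).obj X) n m}
    {v w : List A} {t' : Tm FR X n m} (h : l.Step t v t' w) : w.length = m := by
  obtain ⟨τ, -, -, -, rfl⟩ := h
  exact τ.right.2

/-- Terms whose transitions match up to congruence have the same image under the quotient. -/
theorem DistributiveLaw.map_proj_law_eq {E : Equations FR.{u}} {n m : ℕ}
    {s t : Tm FR ((Beh A κ).obj X) n m}
    (h : ∀ v x w, l.Step s v x w → ∃ y, l.Step t v y w ∧ E.Cong X x y)
    (h' : ∀ v y w, l.Step t v y w → ∃ x, l.Step s v x w ∧ E.Cong X x y) :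
    (Beh A κ).map (E.proj.app X) n m (l.law.app X n m s) =
      (Beh A κ).map (E.proj.app X) n m (l.law.app X n m t) := by
  apply Subtype.ext
  apply Set.Subset.antisymm
  · rintro _ ⟨τ, hτ, rfl⟩
    obtain ⟨y, ⟨ρ, hρ, h1, rfl, h2⟩, hc⟩ := h _ _ _ ⟨τ, hτ, rfl, rfl, rfl⟩
    exact ⟨ρ, hρ, Transition.ext (Subtype.ext h1) (E.cls_eq hc.symm) (Subtype.ext h2)⟩
  · rintro _ ⟨τ, hτ, rfl⟩
    obtain ⟨y, ⟨ρ, hρ, h1, rfl, h2⟩, hc⟩ := h' _ _ _ ⟨τ, hτ, rfl, rfl, rfl⟩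
    exact ⟨ρ, hρ, Transition.ext (Subtype.ext h1) (E.cls_eq hc) (Subtype.ext h2)⟩

/-- The transitions of `s` are those to `t` with labels in the relation `P`. -/
def DistributiveLaw.Loops (l : DistributiveLaw FR.free (Beh A κ)) {X : Sig.{u}} {n m : ℕ}
    (s : Tm FR ((Beh A κ).obj X) n m) (t : Tm FR X n m) (P : List A → List A → Prop) : Prop :=
  ∀ v x w, l.Step s v x w ↔ (v.length = n ∧ w.length = m ∧ P v w) ∧ x = t

/-- Since `Loops` records the lengths separately, a relation on lists matters only at words of the
right lengths, which makes case analysis on letters possible. -/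
theorem DistributiveLaw.Loops.congr {n m : ℕ} {s : Tm FR ((Beh A κ).obj X) n m} {t : Tm FR X n m}
    {P Q : List A → List A → Prop} (h : l.Loops s t P)
    (hPQ : ∀ v w : List A, v.length = n → w.length = m → (P v w ↔ Q v w)) : l.Loops s t Q := by
  intro v x w
  rw [h v x w, and_congr_left_iff]
  exact fun _ => and_congr_right fun hv => and_congr_right fun hw => hPQ v w hv hw

variable (hl : l.Extends (GSOS.coprod (smGSOS hκ) (genGSOS R hR)))
include hl

/-- Labels are plain lists here, so the matching of the middle word is an equality without transport
along arities; lengths are recovered from the steps when needed. -/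
theorem DistributiveLaw.Extends.step_seq {n z m : ℕ} (s : Tm FR ((Beh A κ).obj X) n z)
    (t : Tm FR ((Beh A κ).obj X) z m) (v w : List A) (x : Tm FR X n m) :
    l.Step (FR.seq s t) v x w ↔
      ∃ u s' t', l.Step s v s' u ∧ l.Step t u t' w ∧ x = FR.seq s' t' := by
  unfold DistributiveLaw.Step
  rw [hl.transitions_seq]
  constructor
  · rintro ⟨_, ⟨ρ, hρ, σ, hσ, h, rfl⟩, rfl, rfl, rfl⟩
    exact ⟨_, _, _, ⟨ρ, hρ, rfl, rfl, rfl⟩, ⟨σ, hσ, by rw [h], rfl, rfl⟩, rfl⟩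
  · rintro ⟨_, _, _, ⟨ρ, hρ, rfl, rfl, rfl⟩, ⟨σ, hσ, h, rfl, rfl⟩, rfl⟩
    exact ⟨_, ⟨ρ, hρ, σ, hσ, (Subtype.ext h).symm, rfl⟩, rfl, rfl, rfl⟩

theorem DistributiveLaw.Extends.step_par {n₁ m₁ n₂ m₂ n m : ℕ} (hn : n₁ + n₂ = n)
    (hm : m₁ + m₂ = m) (s : Tm FR ((Beh A κ).obj X) n₁ m₁) (t : Tm FR ((Beh A κ).obj X) n₂ m₂)
    (v w : List A) (x : Tm FR X n m) :
    l.Step (FR.par hn hm s t) v x w ↔ ∃ v₁ w₁ v₂ w₂ s' t', l.Step s v₁ s' w₁ ∧ l.Step t v₂ t' w₂ ∧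
      v = v₁ ++ v₂ ∧ w = w₁ ++ w₂ ∧ x = FR.par hn hm s' t' := by
  unfold DistributiveLaw.Step
  rw [hl.transitions_par]
  constructor
  · rintro ⟨_, ⟨ρ, hρ, σ, hσ, rfl⟩, rfl, rfl, rfl⟩
    exact ⟨_, _, _, _, _, _, ⟨ρ, hρ, rfl, rfl, rfl⟩, ⟨σ, hσ, rfl, rfl, rfl⟩, rfl, rfl, rfl⟩
  · rintro ⟨_, _, _, _, _, _, ⟨ρ, hρ, rfl, rfl, rfl⟩, ⟨σ, hσ, rfl, rfl, rfl⟩, rfl, rfl, rfl⟩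
    exact ⟨_, ⟨ρ, hρ, σ, hσ, rfl⟩, rfl, rfl, rfl⟩

/-- Looping is stable under composition because the target of a composite is the composite of the
targets; the labels compose as relations. -/
theorem DistributiveLaw.Extends.loops_seq {n z m : ℕ} {s : Tm FR ((Beh A κ).obj X) n z}
    {t : Tm FR ((Beh A κ).obj X) z m} {s' : Tm FR X n z} {t' : Tm FR X z m}
    {P Q : List A → List A → Prop} (hs : l.Loops s s' P) (ht : l.Loops t t' Q) :
    l.Loops (FR.seq s t) (FR.seq s' t') (fun v w => ∃ u, u.length = z ∧ P v u ∧ Q u w) := by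
  intro v x w
  rw [hl.step_seq]
  constructor
  · rintro ⟨u, _, _, h1, h2, rfl⟩
    obtain ⟨⟨hv, hu, hP⟩, rfl⟩ := (hs _ _ _).1 h1
    obtain ⟨⟨-, hw, hQ⟩, rfl⟩ := (ht _ _ _).1 h2
    exact ⟨⟨hv, hw, u, hu, hP, hQ⟩, rfl⟩
  · rintro ⟨⟨hv, hw, u, hu, hP, hQ⟩, rfl⟩
    exact ⟨u, _, _, (hs _ _ _).2 ⟨⟨hv, hu, hP⟩, rfl⟩, (ht _ _ _).2 ⟨⟨hu, hw, hQ⟩, rfl⟩, rfl⟩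

/-- The arities determine where each word is cut, so `take` and `drop` replace an existential over
decompositions. -/
theorem DistributiveLaw.Extends.loops_par {n₁ m₁ n₂ m₂ n m : ℕ} (hn : n₁ + n₂ = n)
    (hm : m₁ + m₂ = m) {s : Tm FR ((Beh A κ).obj X) n₁ m₁} {t : Tm FR ((Beh A κ).obj X) n₂ m₂}
    {s' : Tm FR X n₁ m₁} {t' : Tm FR X n₂ m₂}
    {P Q : List A → List A → Prop} (hs : l.Loops s s' P) (ht : l.Loops t t' Q) :
    l.Loops (FR.par hn hm s t) (FR.par hn hm s' t')
      (fun v w => P (v.take n₁) (w.take m₁) ∧ Q (v.drop n₁) (w.drop m₁)) := by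
  intro v x w
  rw [hl.step_par]
  constructor
  · rintro ⟨v₁, w₁, v₂, w₂, _, _, h1, h2, rfl, rfl, rfl⟩
    obtain ⟨⟨rfl, rfl, hP⟩, rfl⟩ := (hs _ _ _).1 h1
    obtain ⟨⟨rfl, rfl, hQ⟩, rfl⟩ := (ht _ _ _).1 h2
    refine ⟨⟨?_, ?_, ?_, ?_⟩, rfl⟩
    · rw [List.length_append, hn]
    · rw [List.length_append, hm]
    · rwa [List.take_left, List.take_left]
    · rwa [List.drop_left, List.drop_left]
  · rintro ⟨⟨hv, hw, hP, hQ⟩, rfl⟩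
    refine ⟨_, _, _, _, _, _, (hs _ _ _).2 ⟨⟨?_, ?_, hP⟩, rfl⟩, (ht _ _ _).2 ⟨⟨?_, ?_, hQ⟩, rfl⟩,
      (List.take_append_drop _ _).symm, (List.take_append_drop _ _).symm, rfl⟩
    all_goals simp only [List.length_take, List.length_drop]; omega

theorem DistributiveLaw.Extends.loops_id1 :
    l.Loops (FR.id1 : Tm FR ((Beh A κ).obj X) 1 1) FR.id1 Eq := by
  intro v x w
  unfold DistributiveLaw.Step
  rw [hl.transitions_id1]
  constructor
  · rintro ⟨_, ⟨k, rfl⟩, rfl, rfl, rfl⟩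
    exact ⟨⟨rfl, rfl, rfl⟩, rfl⟩
  · rintro ⟨⟨hv, -, rfl⟩, rfl⟩
    obtain ⟨k, rfl⟩ := List.length_eq_one_iff.1 hv
    exact ⟨_, ⟨k, rfl⟩, rfl, rfl, rfl⟩

theorem DistributiveLaw.Extends.loops_nil :
    l.Loops (FR.nil : Tm FR ((Beh A κ).obj X) 0 0) FR.nil Eq := by
  intro v x w
  unfold DistributiveLaw.Step
  rw [hl.transitions_nil]
  constructor
  · rintro ⟨_, rfl, rfl, rfl, rfl⟩
    exact ⟨⟨rfl, rfl, rfl⟩, rfl⟩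
  · rintro ⟨⟨hv, -, rfl⟩, rfl⟩
    obtain rfl := List.length_eq_zero_iff.1 hv
    exact ⟨_, rfl, rfl, rfl, rfl⟩

theorem DistributiveLaw.Extends.loops_sym :
    l.Loops (FR.sym : Tm FR ((Beh A κ).obj X) 2 2) FR.sym (fun v w => w = v.reverse) := by
  intro v x w
  unfold DistributiveLaw.Step
  rw [hl.transitions_sym]
  constructor
  · rintro ⟨_, ⟨k, rfl⟩, rfl, rfl, rfl⟩
    exact ⟨⟨rfl, rfl, rfl⟩, rfl⟩
  · rintro ⟨⟨hv, -, rfl⟩, rfl⟩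
    obtain ⟨a, b, rfl⟩ := List.length_eq_two.1 hv
    exact ⟨_, ⟨(a, b), rfl⟩, rfl, rfl, rfl⟩

theorem DistributiveLaw.Extends.loops_gen {n m : ℕ} (g : FrobOp n m)
    {P : List A → List A → Prop} (hP : ∀ p, p ∈ R g ↔ P p.1.1 p.2.1) :
    l.Loops (FR.gen g : Tm FR ((Beh A κ).obj X) n m) (FR.gen g) P := by
  intro v x w
  unfold DistributiveLaw.Step
  rw [hl.transitions_gen]
  constructor
  · rintro ⟨_, ⟨p, hp, rfl⟩, rfl, rfl, rfl⟩
    exact ⟨⟨p.1.2, p.2.2, (hP p).1 hp⟩, rfl⟩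
  · rintro ⟨⟨hv, hw, h⟩, rfl⟩
    exact ⟨_, ⟨(⟨v, hv⟩, ⟨w, hw⟩), (hP _).2 h, rfl⟩, rfl, rfl, rfl⟩

theorem DistributiveLaw.Extends.loops_idN (n : ℕ) :
    l.Loops (FR.idN n : Tm FR ((Beh A κ).obj X) n n) (FR.idN n) Eq := by
  induction n with
  | zero =>
    rw [FR.idN_zero, FR.idN_zero]
    exact hl.loops_nil
  | succ n ih =>
    rw [FR.idN_succ, FR.idN_succ]
    refine (hl.loops_par rfl rfl ih hl.loops_id1).congr fun v w _ _ => ⟨fun h => ?_, ?_⟩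
    · rw [← List.take_append_drop n v, h.1, h.2, List.take_append_drop]
    · rintro rfl
      exact ⟨rfl, rfl⟩

/-- The symmetry moves the first letter of the input to the end. -/
theorem DistributiveLaw.Extends.loops_sym1N (n : ℕ) :
    l.Loops (FR.sym1N n : Tm FR ((Beh A κ).obj X) (1 + n) (n + 1)) (FR.sym1N n)
      (fun v w => w = v.drop 1 ++ v.take 1) := by
  induction n with
  | zero =>
    have h : l.Loops (FR.sym1N 0 : Tm FR ((Beh A κ).obj X) 1 1) (FR.sym1N 0) Eq := by
      rw [FR.sym1N_zero, FR.sym1N_zero]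
      exact hl.loops_id1
    refine h.congr fun v w hv _ => ?_
    obtain ⟨k, rfl⟩ := List.length_eq_one_iff.1 hv
    exact eq_comm
  | succ n ih =>
    rw [FR.sym1N_succ, FR.sym1N_succ]
    refine (hl.loops_seq (hl.loops_par _ rfl ih hl.loops_id1)
      (hl.loops_par (n₂ := 2) (m₂ := 2) rfl rfl (hl.loops_idN n) hl.loops_sym)).congr
      fun v w hv hw => ?_
    obtain ⟨k, u, b, rfl, rfl⟩ := List.exists_cons_append_singleton (v := v) (n := n) (by omega)
    constructor
    · rintro ⟨x, -, ⟨h1, h2⟩, h3, h4⟩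
      -- The smaller symmetry carries `k` past `u` and leaves `b` alone; the basic symmetry then
      -- exchanges `k` and `b`.
      obtain rfl : x = u ++ [k] ++ [b] := by
        rw [← List.take_append_drop (u.length + 1) x, h1, ← h2]
        simp [Nat.add_comm 1]
      rw [← List.take_append_drop u.length w, ← h3, h4]
      simp
    · rintro rfl
      exact ⟨u ++ [k] ++ [b], by simp, ⟨by simp [Nat.add_comm 1, List.take_append],
        by simp [Nat.add_comm 1]⟩, by simp, by simp⟩

/-- This is the converse of the relation of `FR.sym1N`, so the input is written as a function of the
output and the induction splits the output word. -/
theorem DistributiveLaw.Extends.loops_symN1 (n : ℕ) :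
    l.Loops (FR.symN1 n : Tm FR ((Beh A κ).obj X) (n + 1) (1 + n)) (FR.symN1 n)
      (fun v w => v = w.drop 1 ++ w.take 1) := by
  induction n with
  | zero =>
    have h : l.Loops (FR.symN1 0 : Tm FR ((Beh A κ).obj X) 1 1) (FR.symN1 0) Eq := by
      rw [FR.symN1_zero, FR.symN1_zero]
      exact hl.loops_id1
    refine h.congr fun v w _ hw => ?_
    obtain ⟨k, rfl⟩ := List.length_eq_one_iff.1 hw
    exact Iff.rfl
  | succ n ih =>
    rw [FR.symN1_succ, FR.symN1_succ]
    refine (hl.loops_seq (hl.loops_par (n₂ := 2) (m₂ := 2) rfl rfl (hl.loops_idN n) hl.loops_sym)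
      (hl.loops_par (n₁ := n + 1) (m₁ := 1 + n) (n₂ := 1) (m₂ := 1) rfl (Nat.add_assoc 1 n 1) ih
        hl.loops_id1)).congr fun v w hv hw => ?_
    obtain ⟨k, u, b, rfl, rfl⟩ := List.exists_cons_append_singleton (v := w) (n := n) (by omega)
    constructor
    · rintro ⟨x, -, ⟨h1, h2⟩, h3, h4⟩
      obtain rfl : x = u ++ [k] ++ [b] := by
        rw [← List.take_append_drop (u.length + 1) x, h3, h4]
        simp [Nat.add_comm 1]
      -- The rule for `σ` gives its output as the reverse of its input; reversing once more recovers
      -- the input.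
      rw [← List.take_append_drop u.length v, h1, ← List.reverse_reverse (v.drop u.length), ← h2]
      simp
    · rintro rfl
      exact ⟨u ++ [k] ++ [b], by simp, ⟨by simp, by simp⟩,
        by simp [Nat.add_comm 1, List.take_append], by simp [Nat.add_comm 1]⟩

end Step

/-! ### Preservation of the equations of symmetric monoidal categories and of Frobenius equations -/

section Preservation

variable {A : Type u} {κ : Cardinal.{u}} {hκ : Bound A κ}
  {R : ∀ {n m : ℕ}, FrobOp.{u} n m → Set (Word A n × Word A m)}
  {hR : ∀ {n m : ℕ} (g : FrobOp n m), Cardinal.mk (R g) ≤ κ}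
  {l : DistributiveLaw FR.free (Beh A κ)} {X : Sig.{u}}

theorem DistributiveLaw.Loops.map_proj_law_eq {E : Equations FR.{u}} {n m : ℕ}
    {s t : Tm FR ((Beh A κ).obj X) n m} {s' t' : Tm FR X n m} {P : List A → List A → Prop}
    (hs : l.Loops s s' P) (ht : l.Loops t t' P) (hc : E.Cong X s' t') :
    (Beh A κ).map (E.proj.app X) n m (l.law.app X n m s) =
      (Beh A κ).map (E.proj.app X) n m (l.law.app X n m t) := by
  refine DistributiveLaw.map_proj_law_eq ?_ ?_
  · intro v x w h
    obtain ⟨hP, rfl⟩ := (hs _ _ _).1 h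
    exact ⟨t', (ht _ _ _).2 ⟨hP, rfl⟩, hc⟩
  · intro v x w h
    obtain ⟨hP, rfl⟩ := (ht _ _ _).1 h
    exact ⟨s', (hs _ _ _).2 ⟨hP, rfl⟩, hc⟩

/-- A law extending the structural rules satisfies the equations of symmetric monoidal
categories. -/
theorem DistributiveLaw.Extends.sm_law_eq
    (hl : l.Extends (GSOS.coprod (smGSOS hκ) (genGSOS R hR)))
    {E : Equations FR.{u}} (hE : FR.ContainsSM E) {n m : ℕ}
    (x : SM.EqVars ((Beh A κ).obj X) n m) :
    (Beh A κ).map (E.proj.app X) n m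
        (l.law.app X n m (Tm.inl Frob (SM.lhs x) : Tm FR ((Beh A κ).obj X) n m)) =
      (Beh A κ).map (E.proj.app X) n m
        (l.law.app X n m (Tm.inl Frob (SM.rhs x) : Tm FR ((Beh A κ).obj X) n m)) := by
  -- In every case the two matching targets are the two sides of the same equation, with the
  -- variables replaced by the targets of their transitions.
  have hc {n m : ℕ} (x : SM.EqVars (TmSig FR X) n m) :=
    (congrArg₂ (E.Cong X) (FR.join_inl_lhs x) (FR.join_inl_rhs x)).mp (hE X x)
  rw [FR.inl_lhs, FR.inl_rhs]
  cases x with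
  | parAssoc f g h =>
    refine DistributiveLaw.map_proj_law_eq ?_ ?_
    · intro v x w hs
      obtain ⟨_, _, v₃, w₃, _, c, e1, h3, rfl, rfl, rfl⟩ := (hl.step_par _ _ _ _ _ _ _).1 hs
      obtain ⟨v₁, w₁, v₂, w₂, a, b, h1, h2, rfl, rfl, rfl⟩ := (hl.step_par _ _ _ _ _ _ _).1 e1
      exact ⟨_, (hl.step_par _ _ _ _ _ _ _).2 ⟨_, _, _, _, _, _, h1,
        (hl.step_par _ _ _ _ _ _ _).2 ⟨_, _, _, _, _, _, h2, h3, rfl, rfl, rfl⟩,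
        List.append_assoc _ _ _, List.append_assoc _ _ _, rfl⟩, hc (.parAssoc a b c)⟩
    · intro v x w hs
      obtain ⟨v₁, w₁, _, _, a, _, h1, e2, rfl, rfl, rfl⟩ := (hl.step_par _ _ _ _ _ _ _).1 hs
      obtain ⟨v₂, w₂, v₃, w₃, b, c, h2, h3, rfl, rfl, rfl⟩ := (hl.step_par _ _ _ _ _ _ _).1 e2
      exact ⟨_, (hl.step_par _ _ _ _ _ _ _).2 ⟨_, _, _, _, _, _,
        (hl.step_par _ _ _ _ _ _ _).2 ⟨_, _, _, _, _, _, h1, h2, rfl, rfl, rfl⟩, h3,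
        (List.append_assoc _ _ _).symm, (List.append_assoc _ _ _).symm, rfl⟩,
        hc (.parAssoc a b c)⟩
  | parUnitLeft f =>
    refine DistributiveLaw.map_proj_law_eq ?_ ?_
    · intro v x w hs
      obtain ⟨_, _, _, _, _, a, h1, h2, rfl, rfl, rfl⟩ := (hl.step_par _ _ _ _ _ _ _).1 hs
      obtain ⟨⟨hv, -, rfl⟩, rfl⟩ := (hl.loops_nil _ _ _).1 h1
      -- The label of the identity on `0` is empty, so it adds nothing to the words.
      obtain rfl := List.length_eq_zero_iff.1 hv
      exact ⟨_, h2, hc (.parUnitLeft a)⟩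
    · intro v x w hs
      exact ⟨_, (hl.step_par _ _ _ _ _ _ _).2 ⟨[], [], _, _, _, _,
        (hl.loops_nil _ _ _).2 ⟨⟨rfl, rfl, rfl⟩, rfl⟩, hs, rfl, rfl, rfl⟩, hc (.parUnitLeft x)⟩
  | parUnitRight f =>
    refine DistributiveLaw.map_proj_law_eq ?_ ?_
    · intro v x w hs
      obtain ⟨_, _, _, _, a, _, h1, h2, rfl, rfl, rfl⟩ := (hl.step_par _ _ _ _ _ _ _).1 hs
      obtain ⟨⟨hv, -, rfl⟩, rfl⟩ := (hl.loops_nil _ _ _).1 h2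
      obtain rfl := List.length_eq_zero_iff.1 hv
      rw [List.append_nil, List.append_nil]
      exact ⟨_, h1, hc (.parUnitRight a)⟩
    · intro v x w hs
      exact ⟨_, (hl.step_par _ _ _ _ _ _ _).2 ⟨_, _, [], [], _, _, hs,
        (hl.loops_nil _ _ _).2 ⟨⟨rfl, rfl, rfl⟩, rfl⟩, (List.append_nil _).symm,
        (List.append_nil _).symm, rfl⟩, hc (.parUnitRight x)⟩
  | symSym =>
    refine ((hl.loops_seq hl.loops_sym hl.loops_sym).congr fun v w hv hw => ?_).map_proj_law_eq
      (hl.loops_idN 2) (hc .symSym)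
    constructor
    · rintro ⟨u, -, rfl, rfl⟩
      exact (List.reverse_reverse v).symm
    · rintro rfl
      exact ⟨v.reverse, by rwa [List.length_reverse], rfl, (List.reverse_reverse v).symm⟩
  | interchange f g h i =>
    refine DistributiveLaw.map_proj_law_eq ?_ ?_
    · intro v x w hs
      obtain ⟨_, _, _, _, _, _, e1, e2, rfl, rfl, rfl⟩ := (hl.step_par _ _ _ _ _ _ _).1 hs
      obtain ⟨u₁, a, b, h1, h1', rfl⟩ := (hl.step_seq _ _ _ _ _).1 e1
      obtain ⟨u₂, c, d, h2, h2', rfl⟩ := (hl.step_seq _ _ _ _ _).1 e2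
      exact ⟨_, (hl.step_seq _ _ _ _ _).2 ⟨u₁ ++ u₂, _, _,
        (hl.step_par _ _ _ _ _ _ _).2 ⟨_, _, _, _, _, _, h1, h2, rfl, rfl, rfl⟩,
        (hl.step_par _ _ _ _ _ _ _).2 ⟨_, _, _, _, _, _, h1', h2', rfl, rfl, rfl⟩, rfl⟩,
        hc (.interchange a b c d)⟩
    · intro v x w hs
      obtain ⟨_, _, _, e1, e2, rfl⟩ := (hl.step_seq _ _ _ _ _).1 hs
      obtain ⟨_, u₁, _, u₂, a, c, h1, h1', rfl, rfl, rfl⟩ := (hl.step_par _ _ _ _ _ _ _).1 e1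
      obtain ⟨u₁', _, u₂', _, b, d, h2, h2', he, rfl, rfl⟩ := (hl.step_par _ _ _ _ _ _ _).1 e2
      -- The middle word is cut twice, as an output and as an input of a parallel composition. Both
      -- first pieces have the length `z₁`, so the cuts coincide.
      obtain ⟨rfl, rfl⟩ := List.append_inj he (h1.length_right.trans h2.length_left.symm)
      exact ⟨_, (hl.step_par _ _ _ _ _ _ _).2 ⟨_, _, _, _, _, _,
        (hl.step_seq _ _ _ _ _).2 ⟨_, _, _, h1, h2, rfl⟩,
        (hl.step_seq _ _ _ _ _).2 ⟨_, _, _, h1', h2', rfl⟩, rfl, rfl, rfl⟩,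
        hc (.interchange a b c d)⟩
  | seqAssoc f g h =>
    refine DistributiveLaw.map_proj_law_eq ?_ ?_
    · intro v x w hs
      obtain ⟨u, _, c, e1, h3, rfl⟩ := (hl.step_seq _ _ _ _ _).1 hs
      obtain ⟨u', a, b, h1, h2, rfl⟩ := (hl.step_seq _ _ _ _ _).1 e1
      exact ⟨_, (hl.step_seq _ _ _ _ _).2 ⟨_, _, _, h1,
        (hl.step_seq _ _ _ _ _).2 ⟨_, _, _, h2, h3, rfl⟩, rfl⟩, hc (.seqAssoc a b c)⟩
    · intro v x w hs
      obtain ⟨u, a, _, h1, e2, rfl⟩ := (hl.step_seq _ _ _ _ _).1 hs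
      obtain ⟨u', b, c, h2, h3, rfl⟩ := (hl.step_seq _ _ _ _ _).1 e2
      exact ⟨_, (hl.step_seq _ _ _ _ _).2 ⟨_, _, _,
        (hl.step_seq _ _ _ _ _).2 ⟨_, _, _, h1, h2, rfl⟩, h3, rfl⟩, hc (.seqAssoc a b c)⟩
  | seqIdRight f =>
    refine DistributiveLaw.map_proj_law_eq ?_ ?_
    · intro v x w hs
      obtain ⟨u, a, _, h1, h2, rfl⟩ := (hl.step_seq _ _ _ _ _).1 hs
      obtain ⟨⟨-, -, rfl⟩, rfl⟩ := (hl.loops_idN _ _ _ _).1 h2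
      exact ⟨_, h1, hc (.seqIdRight a)⟩
    · intro v x w hs
      exact ⟨_, (hl.step_seq _ _ _ _ _).2 ⟨_, _, _, hs, (hl.loops_idN _ _ _ _).2
        ⟨⟨hs.length_right, hs.length_right, rfl⟩, rfl⟩, rfl⟩, hc (.seqIdRight x)⟩
  | seqIdLeft f =>
    refine DistributiveLaw.map_proj_law_eq ?_ ?_
    · intro v x w hs
      obtain ⟨u, _, a, h1, h2, rfl⟩ := (hl.step_seq _ _ _ _ _).1 hs
      obtain ⟨⟨-, -, rfl⟩, rfl⟩ := (hl.loops_idN _ _ _ _).1 h1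
      exact ⟨_, h2, hc (.seqIdLeft a)⟩
    · intro v x w hs
      exact ⟨_, (hl.step_seq _ _ _ _ _).2 ⟨_, _, _, (hl.loops_idN _ _ _ _).2
        ⟨⟨hs.length_left, hs.length_left, rfl⟩, rfl⟩, hs, rfl⟩, hc (.seqIdLeft x)⟩
  | symNatLeft f =>
    refine DistributiveLaw.map_proj_law_eq ?_ ?_
    · intro v x w hs
      obtain ⟨_, _, _, h1, e2, rfl⟩ := (hl.step_seq _ _ _ _ _).1 hs
      obtain ⟨⟨hv, -, rfl⟩, rfl⟩ := (hl.loops_sym1N _ _ _ _).1 h1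
      obtain ⟨v₁, w₁, _, _, a, _, h1, h2, he, rfl, rfl⟩ := (hl.step_par _ _ _ _ _ _ _).1 e2
      obtain ⟨⟨hk, -, rfl⟩, rfl⟩ := (hl.loops_id1 _ _ _).1 h2
      obtain ⟨k, rfl⟩ := List.length_eq_one_iff.1 hk
      obtain ⟨k', v, rfl⟩ := List.exists_cons_of_length_pos (l := v) (by omega)
      obtain ⟨rfl, rfl⟩ : v = v₁ ∧ k' = k := by simpa using he
      -- The letter that crossed before `f` acted now passes through the identity beside `f`, so the
      -- middle word is this letter followed by the output of `f`.
      refine ⟨_, (hl.step_seq _ _ _ _ _).2 ⟨[k'] ++ w₁, _, _, (hl.step_par _ _ _ _ _ _ _).2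
        ⟨_, _, _, _, _, _, (hl.loops_id1 [k'] _ [k']).2 ⟨⟨rfl, rfl, rfl⟩, rfl⟩, h1, rfl, rfl, rfl⟩,
        (hl.loops_sym1N _ _ _ _).2 ⟨⟨?_, ?_, rfl⟩, rfl⟩, rfl⟩, hc (.symNatLeft a)⟩
      all_goals simp [h1.length_right, Nat.add_comm]
    · intro v x w hs
      obtain ⟨_, _, _, e1, e2, rfl⟩ := (hl.step_seq _ _ _ _ _).1 hs
      obtain ⟨⟨hv, -, rfl⟩, rfl⟩ := (hl.loops_sym1N _ _ _ _).1 e2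
      obtain ⟨_, _, v₁, w₁, _, a, h2, h1, rfl, rfl, rfl⟩ := (hl.step_par _ _ _ _ _ _ _).1 e1
      obtain ⟨⟨hk, -, rfl⟩, rfl⟩ := (hl.loops_id1 _ _ _).1 h2
      obtain ⟨k, rfl⟩ := List.length_eq_one_iff.1 hk
      refine ⟨_, (hl.step_seq _ _ _ _ _).2 ⟨v₁ ++ [k], _, _,
        (hl.loops_sym1N _ _ _ _).2 ⟨⟨?_, ?_, rfl⟩, rfl⟩, (hl.step_par _ _ _ _ _ _ _).2
        ⟨_, _, _, _, _, _, h1, (hl.loops_id1 [k] _ [k]).2 ⟨⟨rfl, rfl, rfl⟩, rfl⟩, rfl, rfl, rfl⟩,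
        rfl⟩, hc (.symNatLeft a)⟩
      all_goals simp [h1.length_left, Nat.add_comm]
  | symNatRight f =>
    refine DistributiveLaw.map_proj_law_eq ?_ ?_
    · intro v x w hs
      obtain ⟨_, _, _, e1, e2, rfl⟩ := (hl.step_seq _ _ _ _ _).1 hs
      obtain ⟨⟨-, -, rfl⟩, rfl⟩ := (hl.loops_symN1 _ _ _ _).1 e1
      obtain ⟨_, _, v₁, w₁, _, a, h2, h1, rfl, rfl, rfl⟩ := (hl.step_par _ _ _ _ _ _ _).1 e2
      obtain ⟨⟨hk, -, rfl⟩, rfl⟩ := (hl.loops_id1 _ _ _).1 h2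
      obtain ⟨k, rfl⟩ := List.length_eq_one_iff.1 hk
      refine ⟨_, (hl.step_seq _ _ _ _ _).2 ⟨w₁ ++ [k], _, _, (hl.step_par _ _ _ _ _ _ _).2
        ⟨_, _, _, _, _, _, h1, (hl.loops_id1 [k] _ [k]).2 ⟨⟨rfl, rfl, rfl⟩, rfl⟩, rfl, rfl, rfl⟩,
        (hl.loops_symN1 _ _ _ _).2 ⟨⟨?_, ?_, rfl⟩, rfl⟩, rfl⟩, hc (.symNatRight a)⟩
      all_goals simp [h1.length_right, Nat.add_comm]
    · intro v x w hs
      obtain ⟨_, _, _, e1, e2, rfl⟩ := (hl.step_seq _ _ _ _ _).1 hs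
      obtain ⟨⟨-, hw, he⟩, rfl⟩ := (hl.loops_symN1 _ _ _ _).1 e2
      obtain ⟨v₁, w₁, _, _, a, _, h1, h2, rfl, rfl, rfl⟩ := (hl.step_par _ _ _ _ _ _ _).1 e1
      obtain ⟨⟨hk, -, rfl⟩, rfl⟩ := (hl.loops_id1 _ _ _).1 h2
      obtain ⟨k, rfl⟩ := List.length_eq_one_iff.1 hk
      -- The relation of `FR.symN1` is oriented from the output, so it is the output word that is
      -- split to identify its first letter with the crossing letter `k`.
      obtain ⟨k', w, rfl⟩ := List.exists_cons_of_length_pos (l := w) (by omega)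
      obtain ⟨rfl, rfl⟩ : w₁ = w ∧ k = k' := by simpa using he
      refine ⟨_, (hl.step_seq _ _ _ _ _).2 ⟨[k] ++ v₁, _, _,
        (hl.loops_symN1 _ _ _ _).2 ⟨⟨?_, ?_, rfl⟩, rfl⟩, (hl.step_par _ _ _ _ _ _ _).2
        ⟨_, _, _, _, _, _, (hl.loops_id1 [k] _ [k]).2 ⟨⟨rfl, rfl, rfl⟩, rfl⟩, h1, rfl, rfl, rfl⟩,
        rfl⟩, hc (.symNatRight a)⟩
      all_goals simp [h1.length_left, Nat.add_comm]

/-- The two sides of each Frobenius equation have the same labels. -/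
def DistributiveLaw.FrobLoops (l : DistributiveLaw FR.free (Beh A κ)) : Prop :=
  ∀ (X : Sig.{u}) {n m : ℕ} (e : FR.EqName.{u} n m), ∃ P : List A → List A → Prop,
    l.Loops (FR.lhs e : Tm FR ((Beh A κ).obj X) n m) (FR.lhs e) P ∧
    l.Loops (FR.rhs e : Tm FR ((Beh A κ).obj X) n m) (FR.rhs e) P

/-- Both sides loop on themselves with the same labels, so their behaviours differ only in the
target, and the two targets are the sides of the equation itself. -/
theorem DistributiveLaw.FrobLoops.preserves_frobEquations (h : l.FrobLoops) :
    l.Preserves FR.frobEquations := by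
  intro X
  funext n m e
  obtain ⟨P, hs, ht⟩ := h X e
  exact hs.map_proj_law_eq ht (FR.containsFrob_frobEquations X e)

theorem DistributiveLaw.FrobLoops.preserves_cwEquations (h : l.FrobLoops)
    (hl : l.Extends (GSOS.coprod (smGSOS hκ) (genGSOS R hR))) :
    l.Preserves FR.cwEquations := by
  intro X
  funext n m x
  rcases x with x | e
  · exact hl.sm_law_eq FR.containsSM_cwEquations x
  · obtain ⟨P, hs, ht⟩ := h X e
    exact hs.map_proj_law_eq ht (FR.containsFrob_cwEquations X e)

/-- Existence, uniqueness, preservation of equations and the quotient for the law that extends the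
prop rules and rules for the Frobenius generators that respect the Frobenius equations. -/
theorem exists_law_of_frobLoops
    (h : ∀ l : DistributiveLaw FR.free (Beh A κ),
      l.Extends (GSOS.coprod (smGSOS hκ) (genGSOS R hR)) → l.FrobLoops) :
    ∃ l : DistributiveLaw FR.free (Beh A κ),
      l.Extends (GSOS.coprod (smGSOS hκ) (genGSOS R hR)) ∧
      (∀ l' : DistributiveLaw FR.free (Beh A κ),
        l'.Extends (GSOS.coprod (smGSOS hκ) (genGSOS R hR)) → l' = l) ∧
      l.Preserves FR.frobEquations ∧
      l.Preserves FR.cwEquations ∧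
      ∃! k : DistributiveLaw CWMonad (Beh A κ), k.IsQuotientOf (E := FR.cwEquations) l := by
  have hl := GSOS.law_extends (GSOS.coprod (smGSOS hκ) (genGSOS R hR))
  -- The structural equations hold whatever the labels of the generators are; the hypothesis enters
  -- only for the Frobenius equations.
  have hp := (h _ hl).preserves_cwEquations hl
  exact ⟨_, hl, fun l' hl' => hl.unique hl', (h _ hl).preserves_frobEquations, hp,
    hp.existsUnique_quotient hl⟩

end Preservation

/-! ### The Frobenius equations as identities of black and white relations -/

section Generators

variable {A : Type u} {κ : Cardinal.{u}} {hκ : Bound A κ} {l : DistributiveLaw FR.free (Beh A κ)}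

theorem card_blackLabels_le (hκ : Bound A κ) {n m : ℕ} (g : FrobOp.{u} n m) :
    Cardinal.mk (blackLabels A g) ≤ κ := by
  cases g <;> exact hκ.range_one _

theorem card_whiteLabels_le [AddCommGroup A] (hκ : Bound A κ) {n m : ℕ} (g : FrobOp.{u} n m) :
    Cardinal.mk (whiteLabels A g) ≤ κ := by
  cases g
  · exact hκ.range_two _
  · exact hκ.singleton _
  · exact hκ.range_two _
  · exact hκ.singleton _

/-- This puts the ranges into the form of relations on lists that `loops_gen` takes. Lengths are
already fixed by the types, so the counit and the unit carry no further condition. -/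
theorem mem_blackLabels {n m : ℕ} (g : FrobOp.{u} n m) (p : Word A n × Word A m) :
    p ∈ blackLabels A g ↔ match g with
      | .comult => p.2.1 = p.1.1 ++ p.1.1
      | .counit => True
      | .mult => p.1.1 = p.2.1 ++ p.2.1
      | .unit => True := by
  obtain ⟨⟨v, hv⟩, ⟨w, hw⟩⟩ := p
  cases g with
  | comult =>
    obtain ⟨a, rfl⟩ := List.length_eq_one_iff.1 hv
    obtain ⟨b, c, rfl⟩ := List.length_eq_two.1 hw
    simp [blackLabels]
    grind
  | counit =>
    obtain ⟨a, rfl⟩ := List.length_eq_one_iff.1 hv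
    obtain rfl := List.length_eq_zero_iff.1 hw
    simp [blackLabels]
  | mult =>
    obtain ⟨a, b, rfl⟩ := List.length_eq_two.1 hv
    obtain ⟨c, rfl⟩ := List.length_eq_one_iff.1 hw
    simp [blackLabels]
    grind
  | unit =>
    obtain rfl := List.length_eq_zero_iff.1 hv
    obtain ⟨a, rfl⟩ := List.length_eq_one_iff.1 hw
    simp [blackLabels]

theorem mem_whiteLabels [AddCommGroup A] {n m : ℕ} (g : FrobOp.{u} n m)
    (p : Word A n × Word A m) :
    p ∈ whiteLabels A g ↔ match g with
      | .comult => p.1.1 = [p.2.1.sum]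
      | .counit => p.1.1 = [0]
      | .mult => p.2.1 = [p.1.1.sum]
      | .unit => p.2.1 = [0] := by
  obtain ⟨⟨v, hv⟩, ⟨w, hw⟩⟩ := p
  cases g with
  | comult =>
    obtain ⟨a, rfl⟩ := List.length_eq_one_iff.1 hv
    obtain ⟨b, c, rfl⟩ := List.length_eq_two.1 hw
    simp [whiteLabels]
    grind
  | counit =>
    obtain ⟨a, rfl⟩ := List.length_eq_one_iff.1 hv
    obtain rfl := List.length_eq_zero_iff.1 hw
    constructor
    · exact fun h => congrArg (fun p : Word A 1 × Word A 0 => p.1.1) h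
    · intro h
      obtain rfl : a = 0 := List.singleton_inj.1 h
      rfl
  | mult =>
    obtain ⟨a, b, rfl⟩ := List.length_eq_two.1 hv
    obtain ⟨c, rfl⟩ := List.length_eq_one_iff.1 hw
    simp [whiteLabels]
    grind
  | unit =>
    obtain rfl := List.length_eq_zero_iff.1 hv
    obtain ⟨a, rfl⟩ := List.length_eq_one_iff.1 hw
    constructor
    · exact fun h => congrArg (fun p : Word A 0 × Word A 1 => p.2.1) h
    · intro h
      obtain rfl : a = 0 := List.singleton_inj.1 h
      rfl

/-- This and the next two lemmas turn the quantifier over the middle word of a composite into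
quantifiers over letters, after which each Frobenius equation is a statement about elements of `A`.
-/
theorem _root_.List.exists_length_one_and {α : Type*} {P : List α → Prop} :
    (∃ u : List α, u.length = 1 ∧ P u) ↔ ∃ a, P [a] := by
  constructor
  · rintro ⟨u, hu, h⟩
    obtain ⟨a, rfl⟩ := List.length_eq_one_iff.1 hu
    exact ⟨a, h⟩
  · rintro ⟨a, h⟩
    exact ⟨_, rfl, h⟩

theorem _root_.List.exists_length_two_and {α : Type*} {P : List α → Prop} :
    (∃ u : List α, u.length = 2 ∧ P u) ↔ ∃ a b, P [a, b] := by
  constructor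
  · rintro ⟨u, hu, h⟩
    obtain ⟨a, b, rfl⟩ := List.length_eq_two.1 hu
    exact ⟨a, b, h⟩
  · rintro ⟨a, b, h⟩
    exact ⟨_, rfl, h⟩

theorem _root_.List.exists_length_three_and {α : Type*} {P : List α → Prop} :
    (∃ u : List α, u.length = 3 ∧ P u) ↔ ∃ a b c, P [a, b, c] := by
  constructor
  · rintro ⟨u, hu, h⟩
    obtain ⟨a, b, c, rfl⟩ := List.length_eq_three.1 hu
    exact ⟨a, b, c, h⟩
  · rintro ⟨a, b, c, h⟩
    exact ⟨_, rfl, h⟩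

open List in
-- The black generators force all letters on their wires to be equal. Both sides of every equation
-- are connected diagrams, so both relate exactly those words whose letters, inputs and outputs
-- together, are all the same.
theorem DistributiveLaw.Extends.frobLoops_black
    {hR : ∀ {n m : ℕ} (g : FrobOp.{u} n m), Cardinal.mk (blackLabels A g) ≤ κ}
    (hl : l.Extends (GSOS.coprod (smGSOS hκ) (genGSOS (blackLabels A) hR))) :
    l.FrobLoops := by
  intro X n m e
  have comult := hl.loops_gen (X := X) FrobOp.comult (P := fun v w => w = v ++ v)
    (mem_blackLabels (A := A) .comult)
  have counit := hl.loops_gen (X := X) FrobOp.counit (P := fun _ _ => True)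
    (mem_blackLabels (A := A) .counit)
  have mult := hl.loops_gen (X := X) FrobOp.mult (P := fun v w => v = w ++ w)
    (mem_blackLabels (A := A) .mult)
  have unit := hl.loops_gen (X := X) FrobOp.unit (P := fun _ _ => True)
    (mem_blackLabels (A := A) .unit)
  cases e with
  | coassoc =>
    refine ⟨_, (hl.loops_seq comult (hl.loops_par rfl rfl comult hl.loops_id1)).congr ?_,
      hl.loops_seq comult (hl.loops_par rfl rfl hl.loops_id1 comult)⟩
    intro v w hv hw
    obtain ⟨a, rfl⟩ := length_eq_one_iff.1 hv
    obtain ⟨b, c, d, rfl⟩ := length_eq_three.1 hw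
    simp
    grind
  | cocomm =>
    refine ⟨_, (hl.loops_seq comult hl.loops_sym).congr ?_, comult⟩
    intro v w hv hw
    obtain ⟨a, rfl⟩ := length_eq_one_iff.1 hv
    obtain ⟨b, c, rfl⟩ := length_eq_two.1 hw
    simp
  | counitLeft =>
    refine ⟨_, (hl.loops_seq comult (hl.loops_par rfl rfl counit hl.loops_id1)).congr ?_,
      hl.loops_id1⟩
    intro v w hv hw
    obtain ⟨a, rfl⟩ := length_eq_one_iff.1 hv
    obtain ⟨b, rfl⟩ := length_eq_one_iff.1 hw
    simp
  | assoc =>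
    refine ⟨_, (hl.loops_seq (hl.loops_par rfl rfl mult hl.loops_id1) mult).congr ?_,
      hl.loops_seq (hl.loops_par rfl rfl hl.loops_id1 mult) mult⟩
    intro v w hv hw
    obtain ⟨a, b, c, rfl⟩ := length_eq_three.1 hv
    obtain ⟨d, rfl⟩ := length_eq_one_iff.1 hw
    simp
    grind
  | comm =>
    refine ⟨_, (hl.loops_seq hl.loops_sym mult).congr ?_, mult⟩
    intro v w hv hw
    obtain ⟨a, b, rfl⟩ := length_eq_two.1 hv
    obtain ⟨c, rfl⟩ := length_eq_one_iff.1 hw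
    simp
    grind
  | unitLeft =>
    refine ⟨_, (hl.loops_seq (hl.loops_par rfl rfl unit hl.loops_id1) mult).congr ?_,
      hl.loops_id1⟩
    intro v w hv hw
    obtain ⟨a, rfl⟩ := length_eq_one_iff.1 hv
    obtain ⟨b, rfl⟩ := length_eq_one_iff.1 hw
    simp
  | special =>
    refine ⟨_, (hl.loops_seq comult mult).congr ?_, hl.loops_id1⟩
    intro v w hv hw
    obtain ⟨a, rfl⟩ := length_eq_one_iff.1 hv
    obtain ⟨b, rfl⟩ := length_eq_one_iff.1 hw
    simp
  | frobLeft =>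
    refine ⟨_, (hl.loops_seq (z := 3) (hl.loops_par rfl rfl comult hl.loops_id1)
      (hl.loops_par rfl rfl hl.loops_id1 mult)).congr ?_, hl.loops_seq mult comult⟩
    intro v w hv hw
    obtain ⟨a, b, rfl⟩ := length_eq_two.1 hv
    obtain ⟨c, d, rfl⟩ := length_eq_two.1 hw
    simp [exists_length_one_and, exists_length_three_and]
    grind
  | frobRight =>
    refine ⟨_, (hl.loops_seq (z := 3) (hl.loops_par rfl rfl hl.loops_id1 comult)
      (hl.loops_par rfl rfl mult hl.loops_id1)).congr ?_, hl.loops_seq mult comult⟩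
    intro v w hv hw
    obtain ⟨a, b, rfl⟩ := length_eq_two.1 hv
    obtain ⟨c, d, rfl⟩ := length_eq_two.1 hw
    simp [exists_length_one_and, exists_length_three_and]
    grind

open List in
-- Both sides of every equation relate exactly the words with equal sum of inputs and sum of
-- outputs. Associativity and commutativity of addition and the neutrality of `0` handle most cases;
-- inverses are called for in the Frobenius laws, where a hidden letter must be solved for.
theorem DistributiveLaw.Extends.frobLoops_white [AddCommGroup A]
    {hR : ∀ {n m : ℕ} (g : FrobOp.{u} n m), Cardinal.mk (whiteLabels A g) ≤ κ}
    (hl : l.Extends (GSOS.coprod (smGSOS hκ) (genGSOS (whiteLabels A) hR))) :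
    l.FrobLoops := by
  intro X n m e
  have comult := hl.loops_gen (X := X) FrobOp.comult (P := fun v w => v = [w.sum])
    (mem_whiteLabels (A := A) .comult)
  have counit := hl.loops_gen (X := X) FrobOp.counit (P := fun v _ => v = [0])
    (mem_whiteLabels (A := A) .counit)
  have mult := hl.loops_gen (X := X) FrobOp.mult (P := fun v w => w = [v.sum])
    (mem_whiteLabels (A := A) .mult)
  have unit := hl.loops_gen (X := X) FrobOp.unit (P := fun _ w => w = [0])
    (mem_whiteLabels (A := A) .unit)
  cases e with
  | coassoc =>
    refine ⟨_, (hl.loops_seq comult (hl.loops_par rfl rfl comult hl.loops_id1)).congr ?_,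
      hl.loops_seq comult (hl.loops_par rfl rfl hl.loops_id1 comult)⟩
    intro v w hv hw
    obtain ⟨a, rfl⟩ := length_eq_one_iff.1 hv
    obtain ⟨b, c, d, rfl⟩ := length_eq_three.1 hw
    simp [exists_length_two_and]
    grind
  | cocomm =>
    refine ⟨_, (hl.loops_seq comult hl.loops_sym).congr ?_, comult⟩
    intro v w hv hw
    obtain ⟨a, rfl⟩ := length_eq_one_iff.1 hv
    obtain ⟨b, c, rfl⟩ := length_eq_two.1 hw
    simp [exists_length_two_and]
    rw [add_comm c b]
  | counitLeft =>
    refine ⟨_, (hl.loops_seq comult (hl.loops_par rfl rfl counit hl.loops_id1)).congr ?_,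
      hl.loops_id1⟩
    intro v w hv hw
    obtain ⟨a, rfl⟩ := length_eq_one_iff.1 hv
    obtain ⟨b, rfl⟩ := length_eq_one_iff.1 hw
    simp [exists_length_two_and]
  | assoc =>
    refine ⟨_, (hl.loops_seq (hl.loops_par rfl rfl mult hl.loops_id1) mult).congr ?_,
      hl.loops_seq (hl.loops_par rfl rfl hl.loops_id1 mult) mult⟩
    intro v w hv hw
    obtain ⟨a, b, c, rfl⟩ := length_eq_three.1 hv
    obtain ⟨d, rfl⟩ := length_eq_one_iff.1 hw
    simp [exists_length_two_and]
    grind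
  | comm =>
    refine ⟨_, (hl.loops_seq hl.loops_sym mult).congr ?_, mult⟩
    intro v w hv hw
    obtain ⟨a, b, rfl⟩ := length_eq_two.1 hv
    obtain ⟨c, rfl⟩ := length_eq_one_iff.1 hw
    simp
    grind
  | unitLeft =>
    refine ⟨_, (hl.loops_seq (hl.loops_par rfl rfl unit hl.loops_id1) mult).congr ?_,
      hl.loops_id1⟩
    intro v w hv hw
    obtain ⟨a, rfl⟩ := length_eq_one_iff.1 hv
    obtain ⟨b, rfl⟩ := length_eq_one_iff.1 hw
    simp [exists_length_two_and]
    exact eq_comm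
  | special =>
    refine ⟨_, (hl.loops_seq comult mult).congr ?_, hl.loops_id1⟩
    intro v w hv hw
    obtain ⟨a, rfl⟩ := length_eq_one_iff.1 hv
    obtain ⟨b, rfl⟩ := length_eq_one_iff.1 hw
    simp [exists_length_two_and]
    constructor
    · rintro ⟨x, y, rfl, rfl⟩
      rfl
    · rintro rfl
      -- Any splitting of `a` into two summands works as the middle word; `a` and `0` is the
      -- simplest.
      exact ⟨a, 0, (add_zero a).symm, (add_zero a).symm⟩
  | frobLeft =>
    refine ⟨_, (hl.loops_seq (z := 3) (hl.loops_par rfl rfl comult hl.loops_id1)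
      (hl.loops_par rfl rfl hl.loops_id1 mult)).congr ?_, hl.loops_seq mult comult⟩
    intro v w hv hw
    obtain ⟨a, b, rfl⟩ := length_eq_two.1 hv
    obtain ⟨c, d, rfl⟩ := length_eq_two.1 hw
    simp [exists_length_three_and]
    constructor
    · rintro ⟨y, rfl, rfl⟩
      exact add_assoc c y b
    · intro h
      -- The letter on the inner wire must satisfy `a = c + y`, which forces `y = a - c`; the other
      -- constraint `d = y + b` is then the equality of sums `a + b = c + d`.
      exact ⟨a - c, (add_sub_cancel c a).symm, by rw [sub_add_eq_add_sub, h, add_sub_cancel_left]⟩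
  | frobRight =>
    refine ⟨_, (hl.loops_seq (z := 3) (hl.loops_par rfl rfl hl.loops_id1 comult)
      (hl.loops_par rfl rfl mult hl.loops_id1)).congr ?_, hl.loops_seq mult comult⟩
    intro v w hv hw
    obtain ⟨a, b, rfl⟩ := length_eq_two.1 hv
    obtain ⟨c, d, rfl⟩ := length_eq_two.1 hw
    simp [exists_length_three_and]
    constructor
    · rintro ⟨y, rfl, rfl⟩
      exact (add_assoc a y d).symm
    · intro h
      -- Mirror image: the inner wire now carries what the comultiplication takes from `b` once `d`
      -- has left, namely `b - d`.
      exact ⟨b - d, (sub_add_cancel b d).symm, by rw [← add_sub_assoc, h, add_sub_cancel_right]⟩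

end Generators

end StringDiag

theorem mainTheorem4 {A : Type u} {κ : Cardinal.{u}} (hκ : StringDiag.Bound A κ) :
    (∃ l : StringDiag.DistributiveLaw StringDiag.FR.free (StringDiag.Beh A κ),
      l.Extends (StringDiag.blackGSOS hκ) ∧
      (∀ l' : StringDiag.DistributiveLaw StringDiag.FR.free (StringDiag.Beh A κ),
        l'.Extends (StringDiag.blackGSOS hκ) → l' = l) ∧
      l.Preserves StringDiag.FR.frobEquations ∧
      l.Preserves StringDiag.FR.cwEquations ∧
      ∃! k : StringDiag.DistributiveLaw StringDiag.CWMonad (StringDiag.Beh A κ),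
        k.IsQuotientOf (E := StringDiag.FR.cwEquations) l) ∧
    ∀ [AddCommGroup A],
      ∃ l : StringDiag.DistributiveLaw StringDiag.FR.free (StringDiag.Beh A κ),
        l.Extends (StringDiag.whiteGSOS hκ) ∧
        (∀ l' : StringDiag.DistributiveLaw StringDiag.FR.free (StringDiag.Beh A κ),
          l'.Extends (StringDiag.whiteGSOS hκ) → l' = l) ∧
        l.Preserves StringDiag.FR.frobEquations ∧
        l.Preserves StringDiag.FR.cwEquations ∧
        ∃! k : StringDiag.DistributiveLaw StringDiag.CWMonad (StringDiag.Beh A κ),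
          k.IsQuotientOf (E := StringDiag.FR.cwEquations) l :=
  -- By definition the black and white specifications are coproducts of the prop rules with rules
  -- for generators; the proofs of the cardinality bounds inside them are irrelevant to equality.
  ⟨StringDiag.exists_law_of_frobLoops (hR := StringDiag.card_blackLabels_le hκ)
      fun _ hl => hl.frobLoops_black,
    StringDiag.exists_law_of_frobLoops (hR := StringDiag.card_whiteLabels_le hκ)
      fun _ hl => hl.frobLoops_white⟩
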